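/- Fix a computable enumeration $f_0,f_1,f_2,\dots$ of all polynomials with integer coefficients in any (finite) number of variables among $X_0,X_1,X_2,\dots$: every such polynomial occurs in the list, and an algorithm computes from $e$ the terms of $f_e$ with their coefficients. For a commutative ring $R$, let $\operatorname{HTP}(R)$ be the set of those indices $e\in\mathbb{N}$ for which $f_e=0$ has a solution with all coordinates in $R$. For a set $\mathcal{S}$ of prime numbers, let $\mathbb{Z}[\mathcal{S}^{-1}]$ be the subring of $\mathbb{Q}$ generated by the inverses of the elements of $\mathcal{S}$. Let $\le_T$ and $\equiv_T$ denote Turing reducibility and Turing equivalence of sets of natural numbers. Then there is a set $\mathcal{S}$ of prime numbers such that the ring $R=\mathbb{Z}[\mathcal{S}^{-1}]\subseteq\mathbb{Q}$ satisfies $\operatorname{HTP}(R)\equiv_T\operatorname{HTP}(\mathbb{Q})$, such that $\mathcal{S}\le_T\operatorname{HTP}(\mathbb{Q})$, and such that infinitely many primes do not belong to $\mathcal{S}$. -/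

import Mathlib

open scoped Computability

/-- The integer polynomial in the variables `X₀, X₁, X₂, …` described by a finite list of terms;
the entry `(a, [k₀, …, kₘ])` stands for the term `a * X₀ ^ k₀ * ⋯ * Xₘ ^ kₘ`. -/
noncomputable def polyOfTerms (c : List (ℤ × List ℕ)) : MvPolynomial ℕ ℤ :=
  (c.map fun t => MvPolynomial.monomial t.2.toFinsupp t.1).sum

/-- `f₀, f₁, f₂, …` is a computable enumeration of all polynomials, in any number of variables,
with integer coefficients: every such polynomial is some `f e`, and an algorithm computes from an
index `e` the (finitely many) terms of `f e` with their coefficients. -/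
def IsComputableEnumeration (f : ℕ → MvPolynomial ℕ ℤ) : Prop :=
  Function.Surjective f ∧
    ∃ g : ℕ → List (ℤ × List ℕ), Computable g ∧ ∀ e, f e = polyOfTerms (g e)

/-- Hilbert's Tenth Problem for the ring `R`, with respect to the enumeration `f`: the set of the
indices of those polynomials that have a root with coordinates in `R`. (Only finitely many
variables occur in `f e`; the values of the other ones do not matter.) -/
def HTP (f : ℕ → MvPolynomial ℕ ℤ) (R : Type*) [CommRing R] : Set ℕ :=
  {e | ∃ x : ℕ → R, MvPolynomial.aeval x (f e) = 0}

/-- The subring `ℤ[S⁻¹]` of `ℚ`, generated by the inverses of the elements of `S`. -/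
def invertPrimes (S : Set ℕ) : Subring ℚ :=
  Subring.closure ((fun p : ℕ => (p : ℚ)⁻¹) '' S)

/-- The characteristic function of a set of natural numbers, as a (total) partial function. -/
noncomputable def charFn (A : Set ℕ) : ℕ →. ℕ :=
  ((A.indicator 1 : ℕ → ℕ) : ℕ →. ℕ)

/-! The primes kept out of `S` are chosen one by one, and `P = s n` is the product of those chosen
before stage `n`. At stage `n` the oracle HTP(ℚ) is asked whether `f n` has a root whose coordinates
have denominators prime to `P`. If so, a root with common denominator `d` prime to `P` is found by
search, and the next excluded prime is taken above `P * d`; later ones are larger still, so `d`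
stays invertible and the root survives in `R`. If not, `R` has no root either, since the primes of
`P` are never inverted. The answer at stage `n` thus decides `f n` over `R`, and the whole run is
computable from HTP(ℚ).

For this the ring of rationals with denominators prime to `P` must be existentially defined over ℚ,
uniformly in `P`. The definition asks that `1 + P t²` or three times it be `c² + r d²`, where `r` is
both `a² + b²` and `x² + P y²`. If all primes of `P` are 3 mod 4 and different from 3, a parity
argument with `p`-adic valuations (`IntegralityCondition.not_dvd_den`) rules out denominators
divisible by such a prime. Conversely, Dirichlet's theorem supplies a prime `r`, and reciprocity
with a case of Legendre's theorem gives the representations (`integralityCondition_of_coprime`).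

The reduction of HTP(ℚ) to HTP(R) is homogenization (`exists_aeval_fractionTerms_iff`) and works for
every subring of ℚ. -/

/-! ### Ternary quadratic forms and prime representations -/

/-- The congruences make `x² + p y² - D z²` a multiple `k * (p * D)`, and the size bounds leave only
`k = 0, 1, 2`; each value yields a solution. -/
theorem exists_sq_add_mul_sq_eq_of_small {p D : ℕ} (hp : ¬ IsSquare p) (hp0 : 0 < p) (hD : 0 < D)
    (hc : p.Coprime D) {s u : ℤ} (hs : (D : ℤ) ∣ s ^ 2 + p) (hu : (p : ℤ) ∣ u ^ 2 - D)
    {x y z : ℤ} (bx : x ^ 2 ≤ (p * D : ℕ)) (bY : y ^ 2 ≤ D) (bz : z ^ 2 ≤ p)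
    (hne0 : x ≠ 0 ∨ y ≠ 0 ∨ z ≠ 0) (e1 : (D : ℤ) ∣ x - s * y) (e2 : (p : ℤ) ∣ x - u * z) :
    ∃ x y z : ℤ, z ≠ 0 ∧ x ^ 2 + p * y ^ 2 = D * z ^ 2 := by
  have d1 : (D : ℤ) ∣ x ^ 2 + p * y ^ 2 - D * z ^ 2 := by
    have : x ^ 2 + p * y ^ 2 - D * z ^ 2 =
      (x - s * y) * (x + s * y) + (s ^ 2 + p) * y ^ 2 - D * z ^ 2 := by ring
    rw [this]
    exact dvd_sub (dvd_add (e1.mul_right _) (hs.mul_right _)) (dvd_mul_right _ _)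
  have d2 : (p : ℤ) ∣ x ^ 2 + p * y ^ 2 - D * z ^ 2 := by
    have : x ^ 2 + p * y ^ 2 - D * z ^ 2 =
      (x - u * z) * (x + u * z) + (u ^ 2 - D) * z ^ 2 + p * y ^ 2 := by ring
    rw [this]
    exact dvd_add (dvd_add (e2.mul_right _) (hu.mul_right _)) (dvd_mul_right _ _)
  have hco : IsCoprime (p : ℤ) (D : ℤ) := Nat.isCoprime_iff_coprime.2 hc
  obtain ⟨k, hk⟩ := hco.mul_dvd d2 d1
  have hp0' : (0 : ℤ) < p := by exact_mod_cast hp0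
  have hD' : (0 : ℤ) < D := by exact_mod_cast hD
  -- Strictness, which comes from `p` not being a square, is what excludes `k = -1`.
  have bz' : z ^ 2 < p := lt_of_le_of_ne bz fun h => hp ⟨z.natAbs, by
    have : ((z.natAbs * z.natAbs : ℕ) : ℤ) = p := by
      rw [← h]; push_cast; rw [← sq, sq_abs]
    exact_mod_cast this.symm⟩
  have hpD : (0 : ℤ) < p * D := mul_pos hp0' hD'
  push_cast at bx
  have hDz : D * z ^ 2 < p * D := by nlinarith
  have hpy : p * y ^ 2 ≤ p * D := by nlinarith
  have hpy0 : 0 ≤ p * y ^ 2 := by positivity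
  have hk0 : -1 < k := by
    by_contra! h
    nlinarith [sq_nonneg x]
  have hk2 : k ≤ 2 := by
    by_contra! h
    nlinarith [sq_nonneg z]
  have hk' : k = 0 ∨ k = 1 ∨ k = 2 := by omega
  rcases hk' with rfl | rfl | rfl
  · refine ⟨x, y, z, fun hz => ?_, by linarith⟩
    subst hz
    have hx : x ^ 2 = 0 := by nlinarith [sq_nonneg x]
    have hy : p * y ^ 2 = 0 := by nlinarith [sq_nonneg x]
    simp_all
  -- Here `x² + p y² = D (z² + p)`; multiply by `z² + p` and use that norms from `ℚ(√-p)` are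
  -- multiplicative.
  · refine ⟨x * z - p * y, x + y * z, z ^ 2 + p, by positivity, ?_⟩
    have : x ^ 2 + p * y ^ 2 = D * (z ^ 2 + p) := by linarith
    calc (x * z - p * y) ^ 2 + p * (x + y * z) ^ 2 = (x ^ 2 + p * y ^ 2) * (z ^ 2 + p) := by ring
      _ = _ := by rw [this]; ring
  -- For `k = 2` all the bounds are attained, so `D = y²`.
  · refine ⟨y, 0, 1, one_ne_zero, ?_⟩
    have h : (p : ℤ) * y ^ 2 = p * D := by nlinarith [sq_nonneg z]
    have := mul_left_cancel₀ hp0'.ne' h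
    linarith

/-- A special case of Legendre's theorem on ternary quadratic forms. -/
theorem exists_sq_add_mul_sq_eq {p D : ℕ} (hp : ¬ IsSquare p) (hp0 : 0 < p) (hD : 0 < D)
    (hc : p.Coprime D) {s u : ℤ} (hs : (D : ℤ) ∣ s ^ 2 + p) (hu : (p : ℤ) ∣ u ^ 2 - D) :
    ∃ x y z : ℤ, z ≠ 0 ∧ x ^ 2 + p * y ^ 2 = D * z ^ 2 := by
  have : NeZero p := ⟨hp0.ne'⟩
  have : NeZero D := ⟨hD.ne'⟩
  let box := Finset.range (Nat.sqrt (p * D) + 1) ×ˢ Finset.range (Nat.sqrt D + 1) ×ˢ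
    Finset.range (Nat.sqrt p + 1)
  let φ : ℕ × ℕ × ℕ → ZMod D × ZMod p := fun v =>
    (((v.1 - s * v.2.1 : ℤ) : ZMod D), ((v.1 - u * v.2.2 : ℤ) : ZMod p))
  -- Pigeonhole: the square of the number of points in the box exceeds `(p * D) * D * p`, so two
  -- points agree in both congruences, and their difference is the small vector wanted.
  have hcard : (Finset.univ : Finset (ZMod D × ZMod p)).card < box.card := by
    have h1 := Nat.lt_succ_sqrt' (p * D)
    have h2 := Nat.lt_succ_sqrt' D
    have h3 := Nat.lt_succ_sqrt' p
    simp only [Finset.card_univ, Fintype.card_prod, ZMod.card, box, Finset.card_product,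
      Finset.card_range, Nat.succ_eq_add_one] at h1 h2 h3 ⊢
    refine lt_of_pow_lt_pow_left₀ 2 (Nat.zero_le _) ?_
    calc (D * p) ^ 2 = (p * D) * (D * p) := by ring
      _ < (Nat.sqrt (p * D) + 1) ^ 2 * ((Nat.sqrt D + 1) ^ 2 * (Nat.sqrt p + 1) ^ 2) :=
        Nat.mul_lt_mul_of_lt_of_le h1 (Nat.mul_le_mul h2.le h3.le) (by positivity)
      _ = _ := by ring
  obtain ⟨v, hv, w, hw, hne, heq⟩ :=
    Finset.exists_ne_map_eq_of_card_lt_of_maps_to hcard (f := φ) (fun _ _ => Finset.mem_univ _)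
  obtain ⟨x₁, y₁, z₁⟩ := v
  obtain ⟨x₂, y₂, z₂⟩ := w
  simp only [box, Finset.mem_product, Finset.mem_range, Nat.lt_succ_iff, Prod.mk.injEq, φ]
    at hv hw heq
  have e1 := (ZMod.intCast_eq_intCast_iff_dvd_sub _ _ _).1 heq.1
  have e2 := (ZMod.intCast_eq_intCast_iff_dvd_sub _ _ _).1 heq.2
  have key : ∀ {a b n : ℕ}, a ≤ n.sqrt → b ≤ n.sqrt → ((a : ℤ) - b) ^ 2 ≤ n := by
    intro a b n ha hb
    have h1 : ((a : ℤ) - b) ^ 2 ≤ (n.sqrt : ℤ) ^ 2 := by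
      rw [sq_le_sq, abs_of_nonneg (Int.natCast_nonneg n.sqrt), abs_le]
      constructor <;> omega
    exact h1.trans (by exact_mod_cast Nat.sqrt_le' n)
  have bx := key hw.1 hv.1
  have bY := key hw.2.1 hv.2.1
  have bz := key hw.2.2 hv.2.2
  have hne0 : (x₂ : ℤ) - x₁ ≠ 0 ∨ (y₂ : ℤ) - y₁ ≠ 0 ∨ (z₂ : ℤ) - z₁ ≠ 0 := by
    by_contra! h
    obtain ⟨h1, h2, h3⟩ := h
    obtain rfl : x₁ = x₂ := by omega
    obtain rfl : y₁ = y₂ := by omega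
    obtain rfl : z₁ = z₂ := by omega
    exact hne rfl
  have e1 : (D : ℤ) ∣ ((x₂ : ℤ) - x₁) - s * ((y₂ : ℤ) - y₁) := by convert e1 using 1; ring
  have e2 : (p : ℤ) ∣ ((x₂ : ℤ) - x₁) - u * ((z₂ : ℤ) - z₁) := by convert e2 using 1; ring
  exact exists_sq_add_mul_sq_eq_of_small hp hp0 hD hc hs hu bx bY bz hne0 e1 e2

theorem Nat.Prime.isSquare_mod_of_jacobiSym_eq_one {p : ℕ} (hp : p.Prime) {a : ℤ}
    (h : jacobiSym a p = 1) : ∃ u : ℤ, (p : ℤ) ∣ u ^ 2 - a := by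
  have : Fact p.Prime := ⟨hp⟩
  obtain ⟨y, hy⟩ := ZMod.isSquare_of_jacobiSym_eq_one h
  refine ⟨y.val, (ZMod.intCast_eq_intCast_iff_dvd_sub _ _ _).1 ?_⟩
  simp [hy, sq]

/-- For `D ≡ 1 mod 4` prime to `P`, the numbers `D` and `2 * D` are represented over `ℚ` by
`c ^ 2 + r * d ^ 2`, for some `r` that is represented by `a ^ 2 + b ^ 2` and `x ^ 2 + P * y ^ 2`. -/
theorem exists_prime_representation {P D : ℕ} (hP : ¬ IsSquare P) (hP2 : Odd P)
    (hD : D % 4 = 1) (hPD : P.Coprime D) {i : ℕ} (hi : i = 1 ∨ i = 2) :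
    ∃ r : ℕ, (∃ a b : ℕ, a ^ 2 + b ^ 2 = r) ∧
      (∃ x y z : ℤ, z ≠ 0 ∧ x ^ 2 + P * y ^ 2 = r * z ^ 2) ∧
      ∃ c d e : ℤ, e ≠ 0 ∧ c ^ 2 + r * d ^ 2 = (i * D : ℕ) * e ^ 2 := by
  have hP0 : 0 < P := hP2.pos
  have hD2 : Odd D := Nat.odd_iff.2 (by omega)
  have hco : (8 * P).Coprime D :=
    Nat.Coprime.mul_left (Nat.Coprime.pow_left 3 (Nat.coprime_two_left.2 hD2)) hPD
  obtain ⟨a, ha1, ha2⟩ := Nat.chineseRemainder hco 1 (D - 1)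
  have hau : a.Coprime (8 * P * D) := by
    refine Nat.Coprime.mul_right ?_ ?_
    · rw [Nat.Coprime, ha1.gcd_eq]; simp
    · rw [Nat.Coprime, ha2.gcd_eq]
      have h1 : Nat.Coprime (D - 1) (D - 1 + 1) := by simp
      rwa [Nat.sub_add_cancel hD2.pos] at h1
  -- Dirichlet gives a prime `r` that is 1 mod `8 * P` and -1 mod `D`. Then `r` is a sum of two
  -- squares, and by reciprocity `-P`, `2` and `D` are squares mod `r`; the other congruences
  -- Legendre needs hold with root 1. The bound makes `r` prime to `P` and `i * D`.
  obtain ⟨r, hrgt, hr, hra⟩ := Nat.forall_exists_prime_gt_and_modEq (2 * D + P)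
    (q := 8 * P * D) (by have := hD2.pos; positivity) hau
  have hr1 : r ≡ 1 [MOD 8 * P] := (hra.of_mul_right D).trans ha1
  have hr2 : r ≡ D - 1 [MOD D] := (hra.of_mul_left (8 * P)).trans ha2
  have hr8 : r ≡ 1 [MOD 8] := hr1.of_mul_right P
  have hrP : r ≡ 1 [MOD P] := hr1.of_mul_left 8
  have hr8' : r % 8 = 1 := hr8
  have hr4 : r % 4 = 1 := by omega
  have hrodd : Odd r := Nat.odd_iff.2 (by omega)
  have : Fact r.Prime := ⟨hr⟩
  have hrn : ¬ IsSquare r := hr.prime.not_isSquare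
  have hPr : (P : ℤ) ∣ 1 ^ 2 - r := by
    simpa using (Nat.modEq_iff_dvd.1 hrP)
  have hDr : (D : ℤ) ∣ 1 ^ 2 + r := by
    have h := Nat.modEq_iff_dvd.1 hr2
    rw [Nat.cast_sub hD2.pos] at h
    have := dvd_sub (dvd_refl (D : ℤ)) h
    have h2 : (D : ℤ) - ((D : ℤ) - (1 : ℕ) - r) = 1 ^ 2 + r := by push_cast; ring
    rwa [h2] at this
  have hJP : jacobiSym (-P) r = 1 := by
    rw [jacobiSym.neg _ hrodd, ZMod.χ₄_nat_one_mod_four hr4, one_mul,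
      jacobiSym.quadratic_reciprocity_one_mod_four' hP2 hr4]
    rw [jacobiSym.mod_left'
        (Int.emod_emod_of_dvd _ (dvd_refl _) |>.symm.trans ?_ : (r : ℤ) % P = 1 % P),
      jacobiSym.one_left]
    rw [Int.emod_emod_of_dvd _ (dvd_refl _)]
    exact_mod_cast hrP
  have hJD : jacobiSym D r = 1 := by
    rw [jacobiSym.quadratic_reciprocity_one_mod_four' hD2 hr4]
    have : (r : ℤ) % D = (-1) % D := Int.ModEq.eq <| Int.modEq_iff_dvd.2 (by
      have h2 : (-1 : ℤ) - r = -(1 ^ 2 + r) := by ring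
      rw [h2]; exact dvd_neg.2 hDr)
    rw [jacobiSym.mod_left' this, jacobiSym.at_neg_one hD2, ZMod.χ₄_nat_one_mod_four hD]
  have hJ2 : jacobiSym 2 r = 1 := by
    rw [jacobiSym.at_two hrodd, ZMod.χ₈_nat_eq_if_mod_eight]
    simp [hr8', Nat.odd_iff.1 hrodd]
  refine ⟨r, Nat.Prime.sq_add_sq (by omega), ?_, ?_⟩
  · obtain ⟨s, hs⟩ := hr.isSquare_mod_of_jacobiSym_eq_one hJP
    refine exists_sq_add_mul_sq_eq hP hP0 hr.pos ?_ (s := s) (u := 1) (by simpa using hs) hPr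
    exact ((Nat.Prime.coprime_iff_not_dvd hr).2 (Nat.not_dvd_of_pos_of_lt hP0 (by omega))).symm
  · have hJi : jacobiSym (i * D : ℕ) r = 1 := by
      rcases hi with rfl | rfl
      · simpa using hJD
      · push_cast; rw [jacobiSym.mul_left, hJ2, hJD]; rfl
    obtain ⟨u, hu⟩ := hr.isSquare_mod_of_jacobiSym_eq_one hJi
    have hiD : 0 < i * D := by have := hD2.pos; rcases hi with rfl | rfl <;> omega
    refine exists_sq_add_mul_sq_eq hrn hr.pos hiD ?_ (s := 1) (u := u) ?_ hu
    · refine (Nat.Prime.coprime_iff_not_dvd hr).2 (Nat.not_dvd_of_pos_of_lt hiD ?_)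
      rcases hi with rfl | rfl <;> omega
    · rcases hi with rfl | rfl
      · simpa using hDr
      · push_cast
        refine IsCoprime.mul_dvd ?_ (by omega) hDr
        exact_mod_cast Nat.isCoprime_iff_coprime.2 (Nat.coprime_two_left.2 hD2)

/-! ### Existential definition of integrality at the primes of `P` -/

/-- For suitable `P`, an existential condition saying that the denominator of `t` is prime
to `P`. -/
def IntegralityCondition (P : ℕ) (t : ℚ) : Prop :=
  ∃ c d a b x y : ℚ,
    ((1 + P * t ^ 2) - (c ^ 2 + (a ^ 2 + b ^ 2) * d ^ 2)) *
      (3 * (1 + P * t ^ 2) - (c ^ 2 + (a ^ 2 + b ^ 2) * d ^ 2)) = 0 ∧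
    (a ^ 2 + b ^ 2) - (x ^ 2 + P * y ^ 2) = 0

theorem Rat.natCast_natAbs_sq (z : ℤ) : ((z.natAbs : ℕ) : ℚ) ^ 2 = (z : ℚ) ^ 2 := by
  rw [Nat.cast_natAbs, Int.cast_abs, sq_abs]

/-- Up to a rational square `1 + P t²` is the integer `N`, which is prime to `P`. Stripping squares
of 2 and possibly multiplying by 3 turns `N` into `D` or `2 * D` with `D` 1 mod 4, the case of
`exists_prime_representation`. -/
theorem integralityCondition_of_coprime {P : ℕ} (hP : ¬ IsSquare P) (hP2 : Odd P)
    (hP3 : P.Coprime 3) {t : ℚ} (ht : P.Coprime t.den) : IntegralityCondition P t := by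
  set N := t.den ^ 2 + P * t.num.natAbs ^ 2 with hN
  have hN0 : N ≠ 0 := by have := t.den_pos; positivity
  have hPN : P.Coprime N := by
    rw [hN, Nat.coprime_add_mul_left_right]
    exact ht.pow_right 2
  obtain ⟨k, m, hm, hkm⟩ := Nat.exists_eq_two_pow_mul_odd hN0
  have hPm : P.Coprime m := hPN.coprime_dvd_right ⟨2 ^ k, by rw [hkm]; ring⟩
  -- The factor 3 corrects an odd part that is 3 mod 4; this is why the condition has two
  -- alternatives.
  obtain ⟨g, D, hg, hD, hPD, hgD⟩ : ∃ g D : ℕ, (g = 1 ∨ g = 3) ∧ D % 4 = 1 ∧ P.Coprime D ∧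
      g * m = D := by
    have := Nat.odd_iff.1 hm
    have : m % 4 = 1 ∨ m % 4 = 3 := by omega
    rcases this with h | h
    · exact ⟨1, m, .inl rfl, h, hPm, one_mul m⟩
    · exact ⟨3, 3 * m, .inr rfl, by omega, hP3.mul_right hPm, rfl⟩
  obtain ⟨i, j, hi, hij⟩ : ∃ i j : ℕ, (i = 1 ∨ i = 2) ∧ 2 ^ k = i * (2 ^ j) ^ 2 := by
    rcases Nat.even_or_odd' k with ⟨j, h | h⟩
    · exact ⟨1, j, .inl rfl, by rw [h]; ring⟩
    · exact ⟨2, j, .inr rfl, by rw [h]; ring⟩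
  obtain ⟨r, ⟨a, b, hab⟩, ⟨x, y, z, hz, hxyz⟩, c, d, e, he, hcde⟩ :=
    exists_prime_representation hP hP2 hD hPD hi
  have hden : (t.den : ℚ) ≠ 0 := by exact_mod_cast t.den_ne_zero
  have he' : (e : ℚ) ≠ 0 := by exact_mod_cast he
  have hz' : (z : ℚ) ≠ 0 := by exact_mod_cast hz
  have hNt : 1 + P * t ^ 2 = N / (t.den : ℚ) ^ 2 := by
    have h1 : ((t.num.natAbs : ℕ) : ℚ) ^ 2 = (t.num : ℚ) ^ 2 := Rat.natCast_natAbs_sq _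
    rw [hN]; push_cast; rw [h1]
    nth_rw 1 [← Rat.num_div_den t]
    field_simp
  have hgN : (g : ℚ) * N = (2 ^ j) ^ 2 * ((i * D : ℕ) : ℚ) := by
    have : g * N = (2 ^ j) ^ 2 * (i * D) := by rw [hkm, ← hgD, hij]; ring
    exact_mod_cast this
  have hab' : (a : ℚ) ^ 2 + (b : ℚ) ^ 2 = r := by exact_mod_cast hab
  have hcde' : (c : ℚ) ^ 2 + r * (d : ℚ) ^ 2 = ((i * D : ℕ) : ℚ) * (e : ℚ) ^ 2 := by
    exact_mod_cast hcde
  have hxyz' : (x : ℚ) ^ 2 + P * (y : ℚ) ^ 2 = r * (z : ℚ) ^ 2 := by exact_mod_cast hxyz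
  have hQ : (2 ^ j * c / (t.den * e) : ℚ) ^ 2 + ((a : ℚ) ^ 2 + (b : ℚ) ^ 2) *
      (2 ^ j * d / (t.den * e) : ℚ) ^ 2 = g * (1 + P * t ^ 2) := by
    rw [hab', hNt, ← mul_div_assoc, hgN]
    field_simp
    linear_combination hcde'
  refine ⟨2 ^ j * c / (t.den * e), 2 ^ j * d / (t.den * e), a, b, x / z, y / z, ?_, ?_⟩
  · rw [hQ]
    rcases hg with rfl | rfl <;> push_cast <;> ring
  · rw [hab', sub_eq_zero]
    field_simp
    linear_combination -hxyz'

/-! ### Valuations at primes that are 3 mod 4 -/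

section Valuation

variable {p : ℕ} [hp : Fact p.Prime]

theorem padicValRat_sq (a : ℚ) : padicValRat p (a ^ 2) = 2 * padicValRat p a := by
  rw [padicValRat.pow]; rfl

/-- Clearing denominators multiplies by a square, which reduces the claim to the two-squares theorem
for natural numbers. -/
theorem even_padicValRat_sq_add_sq (hp4 : p % 4 = 3) {a b : ℚ} (h : a ^ 2 + b ^ 2 ≠ 0) :
    Even (padicValRat p (a ^ 2 + b ^ 2)) := by
  set n := (a.num.natAbs * b.den) ^ 2 + (b.num.natAbs * a.den) ^ 2 with hn
  have hd : ((a.den : ℚ) * b.den) ≠ 0 := by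
    exact_mod_cast mul_ne_zero a.den_ne_zero b.den_ne_zero
  have h1 : (n : ℚ) = (a ^ 2 + b ^ 2) * ((a.den : ℚ) * b.den) ^ 2 := by
    have ha : ((a.num.natAbs : ℕ) : ℚ) ^ 2 = (a.num : ℚ) ^ 2 := Rat.natCast_natAbs_sq _
    have hb : ((b.num.natAbs : ℕ) : ℚ) ^ 2 = (b.num : ℚ) ^ 2 := Rat.natCast_natAbs_sq _
    rw [hn]; push_cast; rw [mul_pow, mul_pow, ha, hb, ← Rat.mul_den_eq_num, ← Rat.mul_den_eq_num]
    ring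
  have hn0 : n ≠ 0 := by
    intro h0
    rw [h0] at h1
    exact mul_ne_zero h (pow_ne_zero 2 hd) (by simpa using h1.symm)
  have hev : Even (padicValNat p n) := by
    by_cases hpn : p ∣ n
    · exact Nat.eq_sq_add_sq_iff.1 ⟨_, _, hn⟩ p (Nat.mem_primeFactors.2 ⟨hp.out, hpn, hn0⟩) hp4
    · rw [padicValNat.eq_zero_of_not_dvd hpn]; exact Even.zero
  have h2 := congrArg (padicValRat p) h1
  rw [padicValRat.mul h (pow_ne_zero 2 hd), padicValRat_sq, padicValRat.of_nat] at h2
  have h3 : Even ((padicValNat p n : ℕ) : ℤ) := (Int.even_coe_nat _).2 hev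
  rw [h2, Int.even_add] at h3
  exact h3.2 (even_two_mul _)

/-- No cancellation can occur in `a² + b²`, as -1 is not a square mod `p`. The proof uses only
parity: if there were cancellation, replacing `a` by `a + p * b` would give a sum of two squares of
odd valuation `1 + 2 v(b)`. -/
theorem padicValRat_sq_add_sq_le (hp4 : p % 4 = 3) {a b : ℚ} (hb : b ≠ 0)
    (h : a ^ 2 + b ^ 2 ≠ 0) : padicValRat p (a ^ 2 + b ^ 2) ≤ 2 * padicValRat p b := by
  by_contra! hlt
  have hp0 : (p : ℚ) ≠ 0 := by exact_mod_cast hp.out.ne_zero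
  have hpv : padicValRat p (p : ℚ) = 1 := padicValRat.self hp.out.one_lt
  have h2p : ¬ p ∣ 2 := fun h2 => by have := Nat.le_of_dvd two_pos h2; interval_cases p <;> omega
  have h2v : padicValRat p (2 : ℚ) = 0 := by
    have := padicValRat.of_nat (p := p) (n := 2)
    rw [padicValNat.eq_zero_of_not_dvd h2p] at this
    exact_mod_cast this
  have hb2 : padicValRat p (b ^ 2) = 2 * padicValRat p b := padicValRat_sq b
  obtain ⟨k, hk⟩ := even_padicValRat_sq_add_sq hp4 h
  have hva : padicValRat p a = padicValRat p b := by
    have ha0 : a ≠ 0 := by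
      rintro rfl
      simp only [ne_eq, OfNat.ofNat_ne_zero, not_false_eq_true, zero_pow, zero_add] at hlt
      omega
    have h3 : padicValRat p (a ^ 2) = padicValRat p (b ^ 2) := by
      have e : -b ^ 2 + (a ^ 2 + b ^ 2) = a ^ 2 := by ring
      rw [← e, padicValRat.add_eq_of_lt (by rw [e]; exact pow_ne_zero 2 ha0)
        (neg_ne_zero.2 (pow_ne_zero 2 hb)) h (by rw [padicValRat.neg]; omega), padicValRat.neg]
    rw [padicValRat_sq, hb2] at h3
    omega
  have ha0 : a ≠ 0 := by
    rintro rfl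
    simp only [ne_eq, OfNat.ofNat_ne_zero, not_false_eq_true, zero_pow, zero_add] at hlt
    omega
  set w := p * (2 * a * b) with hw
  have hw0 : w ≠ 0 := by positivity
  have hwv : padicValRat p w = 1 + 2 * padicValRat p b := by
    rw [hw, padicValRat.mul hp0 (by positivity), padicValRat.mul (by positivity) hb,
      padicValRat.mul two_ne_zero ha0, hpv, h2v, hva]
    ring
  have hpb : (p * b) ^ 2 ≠ 0 := by positivity
  have hpbv : padicValRat p ((p * b) ^ 2) = 2 + 2 * padicValRat p b := by
    rw [padicValRat_sq, padicValRat.mul hp0 hb, hpv]; ring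
  have hs0 : w + (p * b) ^ 2 ≠ 0 := by
    intro h0
    have : w = -(p * b) ^ 2 := by linarith
    have := congrArg (padicValRat p) this
    rw [padicValRat.neg] at this
    omega
  have hs : padicValRat p (w + (p * b) ^ 2) = 1 + 2 * padicValRat p b := by
    rw [padicValRat.add_eq_of_lt hs0 hw0 hpb (by omega), hwv]
  have e : (a + p * b) ^ 2 + b ^ 2 = (w + (p * b) ^ 2) + (a ^ 2 + b ^ 2) := by rw [hw]; ring
  have hne : (a + p * b) ^ 2 + b ^ 2 ≠ 0 := by positivity
  have := even_padicValRat_sq_add_sq hp4 hne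
  rw [e] at this hne
  rw [padicValRat.add_eq_of_lt hne hs0 h (by omega), hs] at this
  obtain ⟨l, hl⟩ := this
  omega

/-- If `p` divided the denominator, `1 + P t²` would have the odd valuation `1 + 2 v(t)`. But `r`
has even valuation, so `x²` dominates in `r = x² + P y²`, and `c² + r d²` has the valuation of `c² +
(x d)²`, which is even. -/
theorem IntegralityCondition.not_dvd_den {P : ℕ} (hP : Squarefree P) (hpP : p ∣ P)
    (hp4 : p % 4 = 3) (hp3 : p ≠ 3) {t : ℚ} (h : IntegralityCondition P t) : ¬ p ∣ t.den := by
  intro hpt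
  obtain ⟨c, d, a, b, x, y, h1, h2⟩ := h
  have hP0 : (P : ℚ) ≠ 0 := by exact_mod_cast hP.ne_zero
  have hPv : padicValRat p (P : ℚ) = 1 := by
    rw [padicValRat.of_nat]
    have h1 : 1 ≤ padicValNat p P := one_le_padicValNat_of_dvd hP.ne_zero hpP
    have h2 : padicValNat p P ≤ 1 := by
      have := (Nat.squarefree_iff_factorization_le_one hP.ne_zero).1 hP p
      rwa [Nat.factorization_def _ hp.out] at this
    exact_mod_cast le_antisymm h2 h1
  have htn : ¬ (p : ℤ) ∣ t.num := fun hn => by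
    have h3 := Nat.dvd_gcd (Int.natCast_dvd.1 hn) hpt
    rw [t.reduced] at h3
    exact hp.out.one_lt.ne' (Nat.dvd_one.1 h3)
  have ht0 : t ≠ 0 := by rintro rfl; simp at htn
  have htv : padicValRat p t < 0 := by
    rw [padicValRat_def, padicValInt.eq_zero_of_not_dvd htn]
    have := one_le_padicValNat_of_dvd t.den_ne_zero hpt
    omega
  have hPt : padicValRat p (P * t ^ 2) = 1 + 2 * padicValRat p t := by
    rw [padicValRat.mul hP0 (pow_ne_zero 2 ht0), padicValRat_sq, hPv]
  have hN0 : (1 : ℚ) + P * t ^ 2 ≠ 0 := by positivity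
  have hNv : padicValRat p (1 + P * t ^ 2) = 1 + 2 * padicValRat p t := by
    rw [add_comm, padicValRat.add_eq_of_lt (by rwa [add_comm]) (by positivity) one_ne_zero
      (by rw [padicValRat.one]; omega), hPt]
  have h3p : ¬ p ∣ 3 := fun h => hp3 ((Nat.prime_dvd_prime_iff_eq hp.out Nat.prime_three).1 h)
  have h3v : padicValRat p (3 : ℚ) = 0 := by
    have := padicValRat.of_nat (p := p) (n := 3)
    rw [padicValNat.eq_zero_of_not_dvd h3p] at this
    exact_mod_cast this
  obtain ⟨hQ0, hQv⟩ : c ^ 2 + (a ^ 2 + b ^ 2) * d ^ 2 ≠ 0 ∧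
      padicValRat p (c ^ 2 + (a ^ 2 + b ^ 2) * d ^ 2) = 1 + 2 * padicValRat p t := by
    rcases mul_eq_zero.1 h1 with h | h
    · rw [← sub_eq_zero.1 h]; exact ⟨hN0, hNv⟩
    · rw [← sub_eq_zero.1 h]
      exact ⟨by positivity, by rw [padicValRat.mul (by norm_num) hN0, h3v, hNv, zero_add]⟩
  have hk : a ^ 2 + b ^ 2 = x ^ 2 + P * y ^ 2 := sub_eq_zero.1 h2
  have hQ : c ^ 2 + (a ^ 2 + b ^ 2) * d ^ 2 = (c ^ 2 + (x * d) ^ 2) + P * (y * d) ^ 2 := by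
    rw [hk]; ring
  rw [hQ] at hQ0 hQv
  have hyd : y * d ≠ 0 := by
    intro h0
    rw [h0] at hQ0 hQv
    simp only [ne_eq, OfNat.ofNat_ne_zero, not_false_eq_true, zero_pow, mul_zero, add_zero]
      at hQ0 hQv
    obtain ⟨l, hl⟩ := even_padicValRat_sq_add_sq hp4 hQ0
    omega
  have hy : y ≠ 0 := left_ne_zero_of_mul hyd
  have hd : d ≠ 0 := right_ne_zero_of_mul hyd
  have hw : padicValRat p (P * (y * d) ^ 2) = 1 + 2 * (padicValRat p y + padicValRat p d) := by
    rw [padicValRat.mul hP0 (pow_ne_zero 2 hyd), padicValRat_sq, hPv, padicValRat.mul hy hd]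
  have hPy : padicValRat p (P * y ^ 2) = 1 + 2 * padicValRat p y := by
    rw [padicValRat.mul hP0 (pow_ne_zero 2 hy), padicValRat_sq, hPv]
  have hk0 : a ^ 2 + b ^ 2 ≠ 0 := by rw [hk]; positivity
  obtain ⟨l, hl⟩ := even_padicValRat_sq_add_sq hp4 hk0
  rw [hk] at hl hk0
  have hx : x ≠ 0 := by
    rintro rfl
    simp only [ne_eq, OfNat.ofNat_ne_zero, not_false_eq_true, zero_pow, zero_add] at hl
    omega
  have hxy : 2 * padicValRat p x < 1 + 2 * padicValRat p y := by
    by_contra! hle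
    have hlt : padicValRat p (P * y ^ 2) < padicValRat p (x ^ 2) := by
      rw [hPy, padicValRat_sq]; omega
    rw [add_comm] at hl hk0
    rw [padicValRat.add_eq_of_lt hk0 (by positivity) (by positivity) hlt] at hl
    omega
  have hxd : x * d ≠ 0 := mul_ne_zero hx hd
  have hu0 : c ^ 2 + (x * d) ^ 2 ≠ 0 := by positivity
  -- Hence `v(c² + (x d)²) ≤ 2 v(x d) < v(P (y d)²)`, so the last summand does not affect the
  -- valuation.
  have hu := padicValRat_sq_add_sq_le hp4 hxd hu0
  rw [padicValRat.mul hx hd] at hu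
  rw [padicValRat.add_eq_of_lt hQ0 hu0 (by positivity) (by omega)] at hQv
  obtain ⟨l', hl'⟩ := even_padicValRat_sq_add_sq hp4 hu0
  omega

end Valuation

/-! ### Primitive recursive arithmetic on integers, lists and primes -/

section IntArithmetic

/-- Makes the coding of ℤ explicit, so that positive and negative parts can be read off by
arithmetic on codes; sums and products are then computed from these parts. -/
theorem Int.encode_eq (z : ℤ) :
    Encodable.encode z = if 0 ≤ z then 2 * z.toNat else 2 * (-z).toNat - 1 := by
  cases z with
  | ofNat n =>
    have : Encodable.encode (Int.ofNat n) = 2 * n := rfl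
    refine this.trans ?_
    have h : 0 ≤ Int.ofNat n := Int.natCast_nonneg n
    rw [if_pos h]
    rfl
  | negSucc n =>
    have : Encodable.encode (Int.negSucc n) = 2 * n + 1 := rfl
    rw [this, if_neg (by simp)]
    simp [Int.neg_negSucc]
    omega

theorem Primrec.int_toNat : Primrec Int.toNat := by
  have h : Primrec fun n : ℕ => if n % 2 = 0 then n / 2 else 0 :=
    Primrec.ite (Primrec.eq.comp (Primrec.nat_mod.comp .id (.const 2)) (.const 0))
      (Primrec.nat_div.comp .id (.const 2)) (.const 0)
  refine (h.comp Primrec.encode).of_eq fun z => ?_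
  rw [Int.encode_eq]
  split_ifs <;> omega

theorem Primrec.int_toNat_neg : Primrec fun z : ℤ => (-z).toNat := by
  have h : Primrec fun n : ℕ => if n % 2 = 0 then 0 else n / 2 + 1 :=
    Primrec.ite (Primrec.eq.comp (Primrec.nat_mod.comp .id (.const 2)) (.const 0))
      (.const 0) (Primrec.succ.comp (Primrec.nat_div.comp .id (.const 2)))
  refine (h.comp Primrec.encode).of_eq fun z => ?_
  rw [Int.encode_eq]
  split_ifs <;> omega

theorem Primrec.int_sub_nat : Primrec₂ fun a b : ℕ => (a : ℤ) - b := by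
  refine Primrec₂.encode_iff.1 ?_
  have h : Primrec fun p : ℕ × ℕ => if p.2 ≤ p.1 then 2 * (p.1 - p.2) else 2 * (p.2 - p.1) - 1 :=
    Primrec.ite (Primrec.nat_le.comp .snd .fst)
      (Primrec.nat_mul.comp (.const 2) (Primrec.nat_sub.comp .fst .snd))
      (Primrec.nat_sub.comp (Primrec.nat_mul.comp (.const 2) (Primrec.nat_sub.comp .snd .fst))
        (.const 1))
  refine h.of_eq fun p => ?_
  dsimp only
  rw [Int.encode_eq]
  split_ifs <;> omega

theorem Primrec.int_add : Primrec₂ ((· + ·) : ℤ → ℤ → ℤ) := by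
  have h : Primrec fun p : ℤ × ℤ =>
      ((p.1.toNat + p.2.toNat : ℕ) : ℤ) - ((-p.1).toNat + (-p.2).toNat : ℕ) :=
    Primrec.int_sub_nat.comp
      (Primrec.nat_add.comp (Primrec.int_toNat.comp .fst) (Primrec.int_toNat.comp .snd))
      (Primrec.nat_add.comp (Primrec.int_toNat_neg.comp .fst) (Primrec.int_toNat_neg.comp .snd))
  exact h.of_eq fun p => by dsimp only; omega

theorem Primrec.int_mul : Primrec₂ ((· * ·) : ℤ → ℤ → ℤ) := by
  have t1 : Primrec fun p : ℤ × ℤ => p.1.toNat := Primrec.int_toNat.comp .fst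
  have t2 : Primrec fun p : ℤ × ℤ => p.2.toNat := Primrec.int_toNat.comp .snd
  have n1 : Primrec fun p : ℤ × ℤ => (-p.1).toNat := Primrec.int_toNat_neg.comp .fst
  have n2 : Primrec fun p : ℤ × ℤ => (-p.2).toNat := Primrec.int_toNat_neg.comp .snd
  have h : Primrec fun p : ℤ × ℤ =>
      ((p.1.toNat * p.2.toNat + (-p.1).toNat * (-p.2).toNat : ℕ) : ℤ) -
        (p.1.toNat * (-p.2).toNat + (-p.1).toNat * p.2.toNat : ℕ) :=
    Primrec.int_sub_nat.comp
      (Primrec.nat_add.comp (Primrec.nat_mul.comp t1 t2) (Primrec.nat_mul.comp n1 n2))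
      (Primrec.nat_add.comp (Primrec.nat_mul.comp t1 n2) (Primrec.nat_mul.comp n1 t2))
  refine h.of_eq fun p => ?_
  have h1 : p.1 = (p.1.toNat : ℤ) - (-p.1).toNat := by omega
  have h2 : p.2 = (p.2.toNat : ℤ) - (-p.2).toNat := by omega
  conv_rhs => rw [h1, h2]
  push_cast
  ring

theorem Primrec.int_natCast : Primrec ((↑) : ℕ → ℤ) :=
  (Primrec.int_sub_nat.comp .id (.const 0)).of_eq fun n => by simp

theorem Primrec.int_pow : Primrec₂ ((· ^ ·) : ℤ → ℕ → ℤ) := by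
  have h : Primrec fun p : ℤ × ℕ => Nat.rec (motive := fun _ => ℤ) 1 (fun _ z => z * p.1) p.2 :=
    Primrec.nat_rec' .snd (.const 1)
      (Primrec.int_mul.comp (Primrec.snd.comp .snd) (Primrec.fst.comp .fst)).to₂
  refine h.of_eq fun p => ?_
  induction p.2 with
  | zero => simp
  | succ n ih => simp only at ih ⊢; rw [pow_succ, ← ih]

end IntArithmetic

section ListArithmetic

variable {α β : Type*} [Primcodable α] [Primcodable β]

theorem Primrec.list_sum_int {f : α → List β} {g : α → β → ℤ} (hf : Primrec f)
    (hg : Primrec₂ g) : Primrec fun a => ((f a).map (g a)).sum := by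
  refine (Primrec.list_foldr (Primrec.list_map hf hg) (.const 0)
    (h := fun _ p => p.1 + p.2)
    (Primrec.int_add.comp (Primrec.fst.comp .snd) (Primrec.snd.comp .snd)).to₂).of_eq fun a => ?_
  rw [List.sum_eq_foldr]

theorem Primrec.list_prod_int {f : α → List β} {g : α → β → ℤ} (hf : Primrec f)
    (hg : Primrec₂ g) : Primrec fun a => ((f a).map (g a)).prod := by
  refine (Primrec.list_foldr (Primrec.list_map hf hg) (.const 1)
    (h := fun _ p => p.1 * p.2)
    (Primrec.int_mul.comp (Primrec.fst.comp .snd) (Primrec.snd.comp .snd)).to₂).of_eq fun a => ?_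
  rw [List.prod_eq_foldr]

theorem Primrec.list_sum_nat {f : α → List β} {g : α → β → ℕ} (hf : Primrec f)
    (hg : Primrec₂ g) : Primrec fun a => ((f a).map (g a)).sum := by
  refine (Primrec.list_foldr (Primrec.list_map hf hg) (.const 0)
    (h := fun _ p => p.1 + p.2)
    (Primrec.nat_add.comp (Primrec.fst.comp .snd) (Primrec.snd.comp .snd)).to₂).of_eq fun a => ?_
  rw [List.sum_eq_foldr]

end ListArithmetic

section NumberPredicates

theorem Nat.prime_primrec : PrimrecPred Nat.Prime := by
  have h1 : PrimrecRel fun (n m : ℕ) => ∀ x < n, 2 ≤ x → ¬ m % x = 0 := by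
    refine (PrimrecRel.forall_lt (R := fun x m => 2 ≤ x → ¬ m % x = 0) ?_).of_eq fun _ _ => Iff.rfl
    have a : PrimrecPred fun p : ℕ × ℕ => ¬ 2 ≤ p.1 := (Primrec.nat_le.comp (.const 2) .fst).not
    have b : PrimrecPred fun p : ℕ × ℕ => ¬ p.2 % p.1 = 0 :=
      (Primrec.eq.comp (Primrec.nat_mod.comp .snd .fst) (.const 0)).not
    exact (a.or b).of_eq fun p => imp_iff_not_or.symm
  have h2 : PrimrecPred fun n : ℕ => 2 ≤ n ∧ ∀ x < n, 2 ≤ x → ¬ n % x = 0 :=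
    (Primrec.nat_le.comp (.const 2) .id).and (h1.comp .id .id)
  refine h2.of_eq fun n => ?_
  rw [Nat.prime_def_lt']
  simp only [← Nat.dvd_iff_mod_eq_zero]
  exact and_congr_right fun _ => forall_congr' fun x => by tauto

end NumberPredicates

/-! ### Term lists: algebra, evaluation, homogenization, zero test -/

section Terms

/-- Multiplication of term lists. -/
def mulTerms (c c' : List (ℤ × List ℕ)) : List (ℤ × List ℕ) :=
  c.flatMap fun t => c'.map fun s => (t.1 * s.1,
    (List.range (t.2.length + s.2.length)).map fun i => t.2.getD i 0 + s.2.getD i 0)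

/-- The term list of a constant. -/
def constTerms (a : ℤ) : List (ℤ × List ℕ) := [(a, [])]

/-- The term list of a variable. -/
def varTerms (i : ℕ) : List (ℤ × List ℕ) := [(1, (List.range i).map (fun _ => 0) ++ [1])]

@[simp]
theorem polyOfTerms_nil : polyOfTerms [] = 0 := rfl

theorem polyOfTerms_cons (t : ℤ × List ℕ) (c : List (ℤ × List ℕ)) :
    polyOfTerms (t :: c) = MvPolynomial.monomial t.2.toFinsupp t.1 + polyOfTerms c := by
  simp [polyOfTerms]

@[simp]
theorem polyOfTerms_append (c c' : List (ℤ × List ℕ)) :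
    polyOfTerms (c ++ c') = polyOfTerms c + polyOfTerms c' := by
  simp [polyOfTerms]

theorem polyOfTerms_flatMap {α : Type*} (l : List α) (F : α → List (ℤ × List ℕ)) :
    polyOfTerms (l.flatMap F) = (l.map fun a => polyOfTerms (F a)).sum := by
  induction l with
  | nil => simp
  | cons a l ih => simp [ih]

@[simp]
theorem polyOfTerms_mulTerms (c c' : List (ℤ × List ℕ)) :
    polyOfTerms (mulTerms c c') = polyOfTerms c * polyOfTerms c' := by
  have key : ∀ t s : ℤ × List ℕ,
      (((List.range (t.2.length + s.2.length)).map fun i =>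
        t.2.getD i 0 + s.2.getD i 0).toFinsupp : ℕ →₀ ℕ) = t.2.toFinsupp + s.2.toFinsupp := by
    intro t s
    ext i
    by_cases hi : i < t.2.length + s.2.length
    · simp [List.getD_eq_getElem?_getD, hi]
    · have h1 : t.2.length ≤ i := by omega
      have h2 : s.2.length ≤ i := by omega
      simp [List.getD_eq_getElem?_getD, hi, h1, h2]
  rw [mulTerms, polyOfTerms_flatMap, polyOfTerms, ← List.sum_map_mul_right]
  congr 2
  funext t
  rw [polyOfTerms, polyOfTerms, ← List.sum_map_mul_left, List.map_map]
  congr 2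
  funext s
  simp only [Function.comp_apply, MvPolynomial.monomial_mul, key]

@[simp]
theorem polyOfTerms_constTerms (a : ℤ) : polyOfTerms (constTerms a) = MvPolynomial.C a := by
  simp [constTerms, polyOfTerms]

@[simp]
theorem polyOfTerms_varTerms (i : ℕ) : polyOfTerms (varTerms i) = MvPolynomial.X i := by
  have : (((List.range i).map (fun _ => 0) ++ [1]).toFinsupp : ℕ →₀ ℕ) = Finsupp.single i 1 := by
    rw [List.toFinsupp_concat_eq_toFinsupp_add_single]
    ext j
    by_cases hj : j < i <;> simp [List.getD_eq_getElem?_getD, hj]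
  simp only [varTerms, polyOfTerms, List.map_cons, List.map_nil, List.sum_cons, List.sum_nil,
    add_zero, this, MvPolynomial.X]

/-- The value of a term list at a point, computed term by term. -/
def evalTerms {K : Type*} [CommRing K] (c : List (ℤ × List ℕ)) (x : ℕ → K) : K :=
  (c.map fun t => (t.1 : K) * ∏ i ∈ Finset.range t.2.length, x i ^ t.2.getD i 0).sum

theorem aeval_polyOfTerms {K : Type*} [CommRing K] (c : List (ℤ × List ℕ)) (x : ℕ → K) :
    MvPolynomial.aeval x (polyOfTerms c) = evalTerms c x := by
  rw [polyOfTerms, map_list_sum, List.map_map, evalTerms]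
  congr 2
  funext t
  rw [Function.comp_apply, MvPolynomial.aeval_monomial]
  congr 1
  exact Finsupp.prod_of_support_subset _ (List.toFinsupp_support_subset _) _ (by simp)

theorem map_evalTerms {K L : Type*} [CommRing K] [CommRing L] (φ : K →+* L)
    (c : List (ℤ × List ℕ)) (x : ℕ → K) : φ (evalTerms c x) = evalTerms c fun i => φ (x i) := by
  rw [evalTerms, map_list_sum, List.map_map, evalTerms]
  congr 2
  funext t
  simp

/-- A bound for the number of variables that occur in a term list. -/
def varBound (c : List (ℤ × List ℕ)) : ℕ := (c.map fun t => t.2.length).sum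

theorem evalTerms_congr {K : Type*} [CommRing K] {c : List (ℤ × List ℕ)} {x y : ℕ → K}
    (h : ∀ i < varBound c, x i = y i) : evalTerms c x = evalTerms c y := by
  rw [evalTerms, evalTerms]
  congr 1
  refine List.map_congr_left fun t ht => ?_
  congr 1
  refine Finset.prod_congr rfl fun i hi => ?_
  rw [h i (lt_of_lt_of_le (Finset.mem_range.1 hi)
    (List.single_le_sum (by simp) _ (List.mem_map_of_mem ht)))]

/-- A bound for the degree of a term list. -/
def degBound (c : List (ℤ × List ℕ)) : ℕ := (c.map fun t => t.2.sum).sum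

/-- Homogenization with the new variable `0`; the variables `1, 2, 3, 4` are left free. -/
def homTerms (c : List (ℤ × List ℕ)) : List (ℤ × List ℕ) :=
  c.map fun t => (t.1, (degBound c - t.2.sum) :: 0 :: 0 :: 0 :: 0 :: t.2)

theorem List.sum_eq_sum_range_getD (l : List ℕ) :
    l.sum = ∑ i ∈ Finset.range l.length, l.getD i 0 := by
  induction l with
  | nil => simp
  | cons a l ih =>
    rw [List.sum_cons, List.length_cons, Finset.sum_range_succ', ih]
    simp [add_comm]

theorem evalTerms_homTerms {K : Type*} [Field K] (c : List (ℤ × List ℕ)) (x : ℕ → K)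
    (h0 : x 0 ≠ 0) :
    evalTerms (homTerms c) x = x 0 ^ degBound c * evalTerms c fun i => x (i + 5) / x 0 := by
  rw [evalTerms, evalTerms, homTerms, List.map_map, ← List.sum_map_mul_left]
  congr 1
  refine List.map_congr_left fun t ht => ?_
  have hle : t.2.sum ≤ degBound c := List.single_le_sum (by simp) _ (List.mem_map_of_mem ht)
  have h1 : ∏ i ∈ Finset.range t.2.length, (x (i + 5) / x 0) ^ t.2.getD i 0 =
      (∏ i ∈ Finset.range t.2.length, x (i + 5) ^ t.2.getD i 0) / x 0 ^ t.2.sum := by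
    simp_rw [div_pow]
    rw [Finset.prod_div_distrib, Finset.prod_pow_eq_pow_sum, ← List.sum_eq_sum_range_getD]
  have h2 : x 0 ^ degBound c = x 0 ^ (degBound c - t.2.sum) * x 0 ^ t.2.sum := by
    rw [← pow_add, Nat.sub_add_cancel hle]
  simp only [Function.comp_apply, List.length_cons, Finset.prod_range_succ', h1, h2]
  simp
  field_simp

/-- Lets a search check rational roots with a given common denominator using integer arithmetic
alone. -/
theorem Int.evalTerms_zero_iff (c : List (ℤ × List ℕ)) (x : ℕ → ℤ) (h0 : x 0 ≠ 0) :
    evalTerms (homTerms c) x = 0 ↔ evalTerms c (fun i => (x (i + 5) : ℚ) / x 0) = 0 := by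
  have h := evalTerms_homTerms (K := ℚ) c (fun i => (x i : ℚ)) (by exact_mod_cast h0)
  rw [← Int.cast_eq_zero (α := ℚ)]
  have h2 := map_evalTerms (Int.castRingHom ℚ) (homTerms c) x
  simp only [eq_intCast] at h2
  rw [h2, h, mul_eq_zero, or_iff_right (pow_ne_zero _ (by exact_mod_cast h0))]

/-- The sum of the coefficients of the terms with given exponents. -/
def coeffTerms (c : List (ℤ × List ℕ)) (L : List ℕ) : ℤ :=
  (c.map fun t : ℤ × List ℕ => if ∀ i ∈ List.range (t.2.length + L.length), t.2.getD i 0 = L.getD i 0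
    then t.1 else 0).sum

theorem coeff_polyOfTerms (c : List (ℤ × List ℕ)) (L : List ℕ) :
    MvPolynomial.coeff L.toFinsupp (polyOfTerms c) = coeffTerms c L := by
  have key : ∀ t : ℤ × List ℕ, (t.2.toFinsupp : ℕ →₀ ℕ) = L.toFinsupp ↔
      ∀ i ∈ List.range (t.2.length + L.length), t.2.getD i 0 = L.getD i 0 := by
    intro t
    rw [Finsupp.ext_iff]
    refine ⟨fun h i _ => h i, fun h i => ?_⟩
    by_cases hi : i < t.2.length + L.length
    · exact h i (List.mem_range.2 hi)
    · rw [List.toFinsupp_apply_le _ _ (by omega), List.toFinsupp_apply_le _ _ (by omega)]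
  rw [polyOfTerms, coeffTerms]
  induction c with
  | nil => simp
  | cons t c ih =>
    simp only [List.map_cons, List.sum_cons, MvPolynomial.coeff_add, ih,
      MvPolynomial.coeff_monomial, key]

/-- Only monomials listed in `c` can have a nonzero coefficient, so vanishing is a finite check. -/
theorem polyOfTerms_eq_zero_iff (c : List (ℤ × List ℕ)) :
    polyOfTerms c = 0 ↔ ∀ t ∈ c, coeffTerms c t.2 = 0 := by
  refine ⟨fun h t _ => by rw [← coeff_polyOfTerms, h, MvPolynomial.coeff_zero], fun h => ?_⟩
  ext m
  rw [MvPolynomial.coeff_zero]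
  by_cases hm : ∃ t ∈ c, t.2.toFinsupp = m
  · obtain ⟨t, ht, rfl⟩ := hm
    rw [coeff_polyOfTerms, h t ht]
  · push Not at hm
    clear h
    induction c with
    | nil => simp
    | cons t c ih =>
      rw [polyOfTerms_cons, MvPolynomial.coeff_add, MvPolynomial.coeff_monomial,
        if_neg (hm t (by simp)), ih fun s hs => hm s (by simp [hs]), add_zero]

end Terms

/-! ### Computability of the operations on term lists -/

section TermsComputability

variable {α : Type*} [Primcodable α]

theorem Primrec.mulTerms : Primrec₂ mulTerms := by
  refine Primrec.list_flatMap .fst ?_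
  refine Primrec.list_map (Primrec.snd.comp .fst) ?_
  have t : Primrec fun p : (((List (ℤ × List ℕ)) × List (ℤ × List ℕ)) × (ℤ × List ℕ)) ×
      (ℤ × List ℕ) => p.1.2 := Primrec.snd.comp .fst
  have s : Primrec fun p : (((List (ℤ × List ℕ)) × List (ℤ × List ℕ)) × (ℤ × List ℕ)) ×
      (ℤ × List ℕ) => p.2 := Primrec.snd
  refine Primrec.pair (Primrec.int_mul.comp (Primrec.fst.comp t) (Primrec.fst.comp s)) ?_
  refine Primrec.list_map (Primrec.list_range.comp (Primrec.nat_add.comp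
    (Primrec.list_length.comp (Primrec.snd.comp t))
    (Primrec.list_length.comp (Primrec.snd.comp s)))) ?_
  exact Primrec.nat_add.comp
    ((Primrec.list_getD 0).comp (Primrec.snd.comp (t.comp .fst)) .snd)
    ((Primrec.list_getD 0).comp (Primrec.snd.comp (s.comp .fst)) .snd)

theorem Primrec.mul_terms {F G : α → List (ℤ × List ℕ)} (hF : Primrec F) (hG : Primrec G) :
    Primrec fun a => _root_.mulTerms (F a) (G a) := Primrec.mulTerms.comp hF hG

theorem Primrec.append_terms {F G : α → List (ℤ × List ℕ)} (hF : Primrec F) (hG : Primrec G) :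
    Primrec fun a => F a ++ G a := Primrec.list_append.comp hF hG

theorem Primrec.constTerms : Primrec constTerms :=
  Primrec.list_cons.comp (Primrec.pair .id (.const [])) (.const [])

theorem Primrec.varTerms : Primrec varTerms :=
  Primrec.list_cons.comp (Primrec.pair (.const 1) (Primrec.list_append.comp
    (Primrec.list_map Primrec.list_range (Primrec.const 0).to₂) (.const [1]))) (.const [])

theorem Primrec.varBound : Primrec varBound :=
  Primrec.list_sum_nat .id (Primrec.list_length.comp (Primrec.snd.comp .snd)).to₂

theorem Primrec.exponent_sum : Primrec fun t : ℤ × List ℕ => t.2.sum := by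
  refine (Primrec.list_sum_nat Primrec.snd (g := fun _ n => n) Primrec.snd.to₂).of_eq fun t => ?_
  simp

theorem Primrec.degBound : Primrec degBound :=
  Primrec.list_sum_nat .id (Primrec.exponent_sum.comp .snd).to₂

theorem Primrec.homTerms : Primrec homTerms := by
  refine Primrec.list_map .id ?_
  refine Primrec.pair (Primrec.fst.comp .snd) ?_
  refine Primrec.list_cons.comp (Primrec.nat_sub.comp (Primrec.degBound.comp .fst)
    (Primrec.exponent_sum.comp .snd)) ?_
  have h : Primrec fun L : List ℕ => 0 :: 0 :: 0 :: 0 :: L :=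
    Primrec.list_cons.comp (.const 0) <| Primrec.list_cons.comp (.const 0) <|
      Primrec.list_cons.comp (.const 0) <| Primrec.list_cons.comp (.const 0) .id
  exact h.comp (Primrec.snd.comp .snd)

theorem Primrec.evalTerms :
    Primrec₂ fun (c : List (ℤ × List ℕ)) (w : List ℤ) => evalTerms c fun i => w.getD i 0 := by
  have h : Primrec₂ fun (c : List (ℤ × List ℕ)) (w : List ℤ) => (c.map fun t => t.1 *
      ((List.range t.2.length).map fun i => w.getD i 0 ^ t.2.getD i 0).prod).sum := by
    refine Primrec.list_sum_int .fst ?_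
    refine Primrec.int_mul.comp (Primrec.fst.comp .snd) ?_
    refine Primrec.list_prod_int (Primrec.list_range.comp
      (Primrec.list_length.comp (Primrec.snd.comp .snd))) ?_
    exact Primrec.int_pow.comp
      ((Primrec.list_getD 0).comp (Primrec.snd.comp (Primrec.fst.comp .fst)) .snd)
      ((Primrec.list_getD 0).comp (Primrec.snd.comp (Primrec.snd.comp .fst)) .snd)
  refine h.of_eq fun c w => ?_
  simp only [_root_.evalTerms, Int.cast_id]
  congr 2

theorem Primrec.coeffTerms : Primrec₂ coeffTerms := by
  refine Primrec.list_sum_int .fst ?_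
  refine Primrec.ite ?_ (Primrec.fst.comp .snd) (.const 0)
  have hR : PrimrecRel fun (i : ℕ) (p : List ℕ × List ℕ) => p.1.getD i 0 = p.2.getD i 0 :=
    Primrec.eq.comp ((Primrec.list_getD 0).comp (Primrec.fst.comp .snd) .fst)
      ((Primrec.list_getD 0).comp (Primrec.snd.comp .snd) .fst)
  have t : Primrec fun p : (List (ℤ × List ℕ) × List ℕ) × (ℤ × List ℕ) => p.2.2 :=
    Primrec.snd.comp .snd
  have s : Primrec fun p : (List (ℤ × List ℕ) × List ℕ) × (ℤ × List ℕ) => p.1.2 :=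
    Primrec.snd.comp .fst
  exact hR.forall_mem_list.comp (Primrec.list_range.comp (Primrec.nat_add.comp
    (Primrec.list_length.comp t) (Primrec.list_length.comp s))) (Primrec.pair t s)

theorem primrecPred_polyOfTerms_eq_zero : PrimrecPred fun c => polyOfTerms c = 0 := by
  have hR : PrimrecRel fun (t : ℤ × List ℕ) (c : List (ℤ × List ℕ)) => coeffTerms c t.2 = 0 :=
    Primrec.eq.comp (Primrec.coeffTerms.comp .snd (Primrec.snd.comp .fst)) (.const 0)
  exact (hR.forall_mem_list.comp .id .id).of_eq fun c => (polyOfTerms_eq_zero_iff c).symm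

/-- Surjectivity guarantees that an unbounded search for an index succeeds; equality of polynomials
is decided by testing their difference for zero. -/
theorem IsComputableEnumeration.exists_index {f : ℕ → MvPolynomial ℕ ℤ}
    (hf : IsComputableEnumeration f) :
    ∃ idx : List (ℤ × List ℕ) → ℕ, Computable idx ∧ ∀ c, f (idx c) = polyOfTerms c := by
  classical
  obtain ⟨hs, g, hg, hfg⟩ := hf
  have hex : ∀ c, ∃ e, f e = polyOfTerms c := fun c => hs _
  have hp : Computable₂ fun (c : List (ℤ × List ℕ)) (e : ℕ) => decide (f e = polyOfTerms c) := by
    have h1 : Computable fun p : List (ℤ × List ℕ) × ℕ => g p.2 := hg.comp .snd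
    have h2 : Primrec₂ fun (c c' : List (ℤ × List ℕ)) =>
        decide (polyOfTerms (c' ++ mulTerms (constTerms (-1)) c) = 0) :=
      primrecPred_polyOfTerms_eq_zero.decide.comp
        (Primrec.append_terms .snd (Primrec.mul_terms (.const _) .fst))
    refine (h2.to_comp.comp Computable.fst h1).of_eq fun p => ?_
    simp only [hfg]
    congr 1
    simp [← sub_eq_add_neg, sub_eq_zero]
  refine ⟨fun c => Nat.find (hex c), (Partrec.rfind hp.partrec₂).of_eq_tot fun c => ?_,
    fun c => Nat.find_spec (hex c)⟩
  rw [Nat.mem_rfind]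
  exact ⟨by simpa using Nat.find_spec (hex c), fun {m} hm => by simpa using Nat.find_min (hex c) hm⟩

end TermsComputability

/-! ### Oracle queries: roots with denominators prime to `P` -/

section Queries

variable {α : Type*} [Primcodable α]

/-- The term list of a square. -/
def sqTerms (c : List (ℤ × List ℕ)) : List (ℤ × List ℕ) := mulTerms c c

/-- The term list of a difference. -/
def subTerms (c c' : List (ℤ × List ℕ)) : List (ℤ × List ℕ) := c ++ mulTerms (constTerms (-1)) c'

@[simp]
theorem polyOfTerms_sqTerms (c : List (ℤ × List ℕ)) :
    polyOfTerms (sqTerms c) = polyOfTerms c ^ 2 := by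
  rw [sqTerms, polyOfTerms_mulTerms, sq]

@[simp]
theorem polyOfTerms_subTerms (c c' : List (ℤ × List ℕ)) :
    polyOfTerms (subTerms c c') = polyOfTerms c - polyOfTerms c' := by
  simp [subTerms, sub_eq_add_neg]

theorem Primrec.sq_terms {F : α → List (ℤ × List ℕ)} (hF : Primrec F) :
    Primrec fun a => sqTerms (F a) := Primrec.mul_terms hF hF

theorem Primrec.sub_terms {F G : α → List (ℤ × List ℕ)} (hF : Primrec F) (hG : Primrec G) :
    Primrec fun a => subTerms (F a) (G a) :=
  Primrec.append_terms hF (Primrec.mul_terms (.const _) hG)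

/-- The term list of `1 + P * t ^ 2`. -/
def onePlusTerms (P : ℕ) (t : List (ℤ × List ℕ)) : List (ℤ × List ℕ) :=
  constTerms 1 ++ mulTerms (constTerms P) (sqTerms t)

/-- The term list of `a ^ 2 + P * b ^ 2`. -/
def normTerms (P : ℕ) (a b : List (ℤ × List ℕ)) : List (ℤ × List ℕ) :=
  sqTerms a ++ mulTerms (constTerms P) (sqTerms b)

theorem Primrec.onePlus_terms {P : α → ℕ} {F : α → List (ℤ × List ℕ)} (hP : Primrec P)
    (hF : Primrec F) : Primrec fun a => onePlusTerms (P a) (F a) :=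
  Primrec.append_terms (.const _)
    (Primrec.mul_terms (Primrec.constTerms.comp (Primrec.int_natCast.comp hP))
      (Primrec.sq_terms hF))

theorem Primrec.norm_terms {P : α → ℕ} {F G : α → List (ℤ × List ℕ)} (hP : Primrec P)
    (hF : Primrec F) (hG : Primrec G) : Primrec fun a => normTerms (P a) (F a) (G a) :=
  Primrec.append_terms (Primrec.sq_terms hF)
    (Primrec.mul_terms (Primrec.constTerms.comp (Primrec.int_natCast.comp hP))
      (Primrec.sq_terms hG))

/-- The term list of `c ^ 2 + (a ^ 2 + b ^ 2) * d ^ 2`. -/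
def mixedTerms (a b c d : List (ℤ × List ℕ)) : List (ℤ × List ℕ) :=
  sqTerms c ++ mulTerms (normTerms 1 a b) (sqTerms d)

theorem Primrec.mixed_terms {F G H I : α → List (ℤ × List ℕ)} (hF : Primrec F) (hG : Primrec G)
    (hH : Primrec H) (hI : Primrec I) :
    Primrec fun x => mixedTerms (F x) (G x) (H x) (I x) :=
  Primrec.append_terms (Primrec.sq_terms hH)
    (Primrec.mul_terms (Primrec.norm_terms (.const 1) hF hG) (Primrec.sq_terms hI))

/-- The term list of a polynomial in `t` and in six auxiliary variables, beyond the first `v`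
ones, that expresses the integrality condition on `t`. -/
def conditionTerms (P v : ℕ) (t : List (ℤ × List ℕ)) : List (ℤ × List ℕ) :=
  sqTerms (mulTerms
    (subTerms (onePlusTerms P t)
      (mixedTerms (varTerms (v + 2)) (varTerms (v + 3)) (varTerms v) (varTerms (v + 1))))
    (subTerms (mulTerms (constTerms 3) (onePlusTerms P t))
      (mixedTerms (varTerms (v + 2)) (varTerms (v + 3)) (varTerms v) (varTerms (v + 1))))) ++
  sqTerms (subTerms (normTerms 1 (varTerms (v + 2)) (varTerms (v + 3)))
    (normTerms P (varTerms (v + 4)) (varTerms (v + 5))))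

theorem Primrec.condition_terms {P v : α → ℕ} {F : α → List (ℤ × List ℕ)} (hP : Primrec P)
    (hv : Primrec v) (hF : Primrec F) : Primrec fun a => conditionTerms (P a) (v a) (F a) := by
  have aux : ∀ j, Primrec fun a => _root_.varTerms (v a + j) := fun j =>
    Primrec.varTerms.comp (Primrec.nat_add.comp hv (.const j))
  have Q := Primrec.mixed_terms (aux 2) (aux 3) (aux 0) (aux 1)
  have N := Primrec.onePlus_terms hP hF
  exact Primrec.append_terms
    (Primrec.sq_terms (Primrec.mul_terms (Primrec.sub_terms N Q)
      (Primrec.sub_terms (Primrec.mul_terms (.const _) N) Q)))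
    (Primrec.sq_terms (Primrec.sub_terms (Primrec.norm_terms (.const 1) (aux 2) (aux 3))
      (Primrec.norm_terms hP (aux 4) (aux 5))))

/-- The term list of a polynomial that has a rational root if and only if `c` has a root whose
coordinates have denominators prime to `P`. -/
def queryTerms (P : ℕ) (c : List (ℤ × List ℕ)) : List (ℤ × List ℕ) :=
  sqTerms c ++ (List.range (varBound c)).flatMap fun i =>
    conditionTerms P (varBound c + 6 * i) (varTerms i)

theorem Primrec.queryTerms : Primrec₂ queryTerms := by
  have h : Primrec fun p : (ℕ × List (ℤ × List ℕ)) × ℕ =>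
      conditionTerms p.1.1 (_root_.varBound p.1.2 + 6 * p.2) (_root_.varTerms p.2) :=
    Primrec.condition_terms (Primrec.fst.comp .fst)
      (Primrec.nat_add.comp (Primrec.varBound.comp (Primrec.snd.comp .fst))
        (Primrec.nat_mul.comp (.const 6) .snd)) (Primrec.varTerms.comp .snd)
  exact Primrec.append_terms (Primrec.sq_terms .snd)
    (Primrec.list_flatMap (Primrec.list_range.comp (Primrec.varBound.comp .snd)) h.to₂)

theorem List.sum_map_eq_zero_iff {ι : Type*} {l : List ι} {F : ι → ℚ} (h0 : ∀ a ∈ l, 0 ≤ F a) :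
    (l.map F).sum = 0 ↔ ∀ a ∈ l, F a = 0 := by
  induction l with
  | nil => simp
  | cons a l ih =>
    have h1 : 0 ≤ (l.map F).sum := List.sum_nonneg (by
      intro x hx
      obtain ⟨b, hb, rfl⟩ := List.mem_map.1 hx
      exact h0 b (by simp [hb]))
    rw [List.map_cons, List.sum_cons, add_eq_zero_iff_of_nonneg (h0 a (by simp)) h1,
      ih fun b hb => h0 b (by simp [hb])]
    simp

theorem aeval_conditionTerms (P v i : ℕ) (x : ℕ → ℚ) :
    MvPolynomial.aeval x (polyOfTerms (conditionTerms P v (varTerms i))) =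
      (((1 + P * x i ^ 2) - (x v ^ 2 + (x (v + 2) ^ 2 + x (v + 3) ^ 2) * x (v + 1) ^ 2)) *
        (3 * (1 + P * x i ^ 2) -
          (x v ^ 2 + (x (v + 2) ^ 2 + x (v + 3) ^ 2) * x (v + 1) ^ 2))) ^ 2 +
      ((x (v + 2) ^ 2 + x (v + 3) ^ 2) - (x (v + 4) ^ 2 + P * x (v + 5) ^ 2)) ^ 2 := by
  simp [conditionTerms, onePlusTerms, mixedTerms, normTerms]

/-- Over ℚ a sum of squares vanishes only if every term does, so one equation expresses the whole
system. -/
theorem exists_aeval_queryTerms_iff (P : ℕ) (c : List (ℤ × List ℕ)) :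
    (∃ x : ℕ → ℚ, MvPolynomial.aeval x (polyOfTerms (queryTerms P c)) = 0) ↔
      ∃ x : ℕ → ℚ, MvPolynomial.aeval x (polyOfTerms c) = 0 ∧
        ∀ i < varBound c, IntegralityCondition P (x i) := by
  have key : ∀ x : ℕ → ℚ, MvPolynomial.aeval x (polyOfTerms (queryTerms P c)) = 0 ↔
      MvPolynomial.aeval x (polyOfTerms c) = 0 ∧ ∀ i < varBound c,
        MvPolynomial.aeval x (polyOfTerms (conditionTerms P (varBound c + 6 * i) (varTerms i)))
          = 0 := by
    intro x
    have h0 : ∀ i ∈ List.range (varBound c), 0 ≤ MvPolynomial.aeval x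
        (polyOfTerms (conditionTerms P (varBound c + 6 * i) (varTerms i))) := by
      intro i _
      rw [aeval_conditionTerms]
      positivity
    have h1 := List.sum_nonneg (l := (List.range (varBound c)).map fun i => MvPolynomial.aeval x
        (polyOfTerms (conditionTerms P (varBound c + 6 * i) (varTerms i)))) (by
      intro y hy
      obtain ⟨i, hi, rfl⟩ := List.mem_map.1 hy
      exact h0 i hi)
    rw [queryTerms, polyOfTerms_append, polyOfTerms_sqTerms, polyOfTerms_flatMap, map_add, map_pow,
      map_list_sum, List.map_map]
    refine (add_eq_zero_iff_of_nonneg (sq_nonneg _) h1).trans (and_congr (by simp) ?_)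
    refine (List.sum_map_eq_zero_iff h0).trans (by simp)
  simp only [key, aeval_conditionTerms]
  constructor
  · rintro ⟨x, h1, h2⟩
    refine ⟨x, h1, fun i hi => ?_⟩
    obtain ⟨h3, h4⟩ := (add_eq_zero_iff_of_nonneg (sq_nonneg _) (sq_nonneg _)).1 (h2 i hi)
    exact ⟨_, _, _, _, _, _, pow_eq_zero_iff two_ne_zero |>.1 h3, pow_eq_zero_iff two_ne_zero |>.1 h4⟩
  · rintro ⟨x, h1, h2⟩
    choose! y hy using show ∀ i, ∃ y : ℕ → ℚ, i < varBound c →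
        (((1 + P * x i ^ 2) - (y 0 ^ 2 + (y 2 ^ 2 + y 3 ^ 2) * y 1 ^ 2)) *
          (3 * (1 + P * x i ^ 2) - (y 0 ^ 2 + (y 2 ^ 2 + y 3 ^ 2) * y 1 ^ 2))) = 0 ∧
        (y 2 ^ 2 + y 3 ^ 2) - (y 4 ^ 2 + P * y 5 ^ 2) = 0 from fun i => by
      by_cases hi : i < varBound c
      · obtain ⟨e, d, a, b, u, v, h3, h4⟩ := h2 i hi
        exact ⟨fun j => [e, d, a, b, u, v].getD j 0, fun _ => ⟨h3, h4⟩⟩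
      · exact ⟨0, fun h => absurd h hi⟩
    -- The witnesses for variable `i` go into their own block of six variables starting at `varBound
    -- c + 6 * i`, so that the blocks do not interfere.
    have hlow : ∀ i < varBound c, (fun n => if n < varBound c then x n else
        y ((n - varBound c) / 6) ((n - varBound c) % 6)) i = x i := fun i hi => if_pos hi
    have hhigh : ∀ i, ∀ j < 6, (fun n => if n < varBound c then x n else
        y ((n - varBound c) / 6) ((n - varBound c) % 6)) (varBound c + 6 * i + j) = y i j := by
      intro i j hj
      have e1 : (varBound c + 6 * i + j - varBound c) / 6 = i := by omega
      have e2 : (varBound c + 6 * i + j - varBound c) % 6 = j := by omega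
      simp only [e1, e2]
      exact if_neg (by omega)
    generalize (fun n => if n < varBound c then x n else
        y ((n - varBound c) / 6) ((n - varBound c) % 6)) = z at hlow hhigh
    refine ⟨z, ?_, fun i hi => ?_⟩
    · rw [← h1, aeval_polyOfTerms, aeval_polyOfTerms]
      exact evalTerms_congr hlow
    · have h0 := hhigh i 0 (by norm_num)
      rw [add_zero] at h0
      rw [hlow i hi, h0, hhigh i 1 (by norm_num), hhigh i 2 (by norm_num),
        hhigh i 3 (by norm_num), hhigh i 4 (by norm_num), hhigh i 5 (by norm_num),
        (hy i hi).1, (hy i hi).2]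
      norm_num

end Queries

/-! ### Recursion relative to an oracle -/

section RelativeRecursion

theorem Nat.RecursiveIn.of_computable {O : Set (ℕ →. ℕ)} {φ : ℕ → ℕ} (h : Computable φ) :
    Nat.RecursiveIn O (φ : ℕ →. ℕ) :=
  Nat.Partrec.recursiveIn (Partrec.nat_iff.1 h.partrec)

theorem Nat.RecursiveIn.comp_total {O : Set (ℕ →. ℕ)} {φ ψ : ℕ → ℕ}
    (hφ : Nat.RecursiveIn O (φ : ℕ →. ℕ)) (hψ : Nat.RecursiveIn O (ψ : ℕ →. ℕ)) :
    Nat.RecursiveIn O ((fun n => φ (ψ n) : ℕ → ℕ) : ℕ →. ℕ) :=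
  (Nat.RecursiveIn.comp hφ hψ).of_eq fun n => Part.bind_some (ψ n) (φ : ℕ →. ℕ)

theorem Nat.RecursiveIn.pair_total {O : Set (ℕ →. ℕ)} {φ ψ : ℕ → ℕ}
    (hφ : Nat.RecursiveIn O (φ : ℕ →. ℕ)) (hψ : Nat.RecursiveIn O (ψ : ℕ →. ℕ)) :
    Nat.RecursiveIn O ((fun n => Nat.pair (φ n) (ψ n) : ℕ → ℕ) : ℕ →. ℕ) :=
  (Nat.RecursiveIn.pair hφ hψ).of_eq fun n => by simp [Seq.seq]

/-- A sequence that is computed by iteration of a partial recursive step, with one oracle query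
for each step, is recursive in the oracle. -/
theorem Nat.RecursiveIn.iterate {O : Set (ℕ →. ℕ)} {H : ℕ → ℕ} (hH : (H : ℕ →. ℕ) ∈ O)
    {query : ℕ × ℕ → ℕ} (hq : Computable query) {step : ℕ × ℕ × ℕ →. ℕ} (hstep : Partrec step)
    {s : ℕ → ℕ} (hs : ∀ n, s (n + 1) ∈ step (n, s n, H (query (n, s n)))) :
    Nat.RecursiveIn O (s : ℕ →. ℕ) := by
  -- The step of `prec` receives a code of `(parameter, (n, s n))`. The parameter is a dummy 0, so
  -- only the second component is used.
  have hq' : Computable fun p : ℕ => query (p.unpair.2.unpair) :=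
    hq.comp (Computable.unpair.comp (Computable.snd.comp Computable.unpair))
  have hr : Computable fun p : ℕ => p.unpair.2 := Computable.snd.comp Computable.unpair
  have hA := Nat.RecursiveIn.comp_total (Nat.RecursiveIn.oracle (O := O) _ hH)
    (Nat.RecursiveIn.of_computable hq')
  have hB := Nat.RecursiveIn.pair_total (Nat.RecursiveIn.of_computable (O := O) hr) hA
  have hC : Partrec fun n : ℕ =>
      step (n.unpair.1.unpair.1, n.unpair.1.unpair.2, n.unpair.2) := by
    have h1 : Computable fun n : ℕ => n.unpair.1.unpair :=
      Computable.unpair.comp (Computable.fst.comp Computable.unpair)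
    exact hstep.comp ((Computable.fst.comp h1).pair ((Computable.snd.comp h1).pair hr))
  have hD := Nat.RecursiveIn.comp (Nat.Partrec.recursiveIn (Partrec.nat_iff.1 hC)) hB
  have hE := Nat.RecursiveIn.prec
    (Nat.RecursiveIn.of_computable (O := O) (Computable.const (s 0))) hD
  have hF := Nat.RecursiveIn.comp hE (Nat.RecursiveIn.of_computable (O := O)
    (φ := fun n => Nat.pair 0 n)
    ((Primrec₂.natPair.comp (_root_.Primrec.const 0) _root_.Primrec.id).to_comp))
  refine hF.of_eq_tot fun n => ?_
  simp only [PFun.coe_val, Part.bind_eq_bind, Part.bind_some, Nat.unpair_pair]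
  induction n with
  | zero => simp
  | succ n ih =>
    refine Part.mem_bind_iff.2 ⟨s n, ih, ?_⟩
    simpa using hs n

/-- Unlike in a many-one reduction, `r` may consult the oracle; this matters because the query about
`f e` depends on the stage `s e`. -/
theorem turingReducible_of_forall_mem_iff {A B : Set ℕ} {r : ℕ → ℕ}
    (hr : RecursiveIn {charFn B} (r : ℕ →. ℕ)) (h : ∀ n, n ∈ A ↔ r n ∈ B) :
    charFn A ≤ᵀ charFn B := by
  classical
  have := Nat.RecursiveIn.comp_total
    (Nat.RecursiveIn.oracle (O := {charFn B}) _ (Set.mem_singleton _)) (RecursiveIn.iff_nat.1 hr)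
  refine RecursiveIn.iff_nat.2 (this.of_eq fun n => ?_)
  simp only [charFn, PFun.coe_val, Set.indicator_apply, h, Pi.one_apply]

end RelativeRecursion

/-! ### Subrings of ℚ and the reduction from ℚ to a subring -/

section Subrings

theorem Rat.den_not_dvd_of_mem_invertPrimes {S : Set ℕ} (hS : ∀ q ∈ S, q.Prime) {p : ℕ}
    (hp : p.Prime) (hpS : p ∉ S) {x : ℚ} (hx : x ∈ invertPrimes S) : ¬ p ∣ x.den := by
  induction hx using Subring.closure_induction with
  | mem x hx =>
    obtain ⟨q, hq, rfl⟩ := hx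
    intro h
    have h0 := (hS q hq).ne_zero
    simp only [Rat.inv_natCast_den, h0, if_false] at h
    exact hpS ((Nat.prime_dvd_prime_iff_eq hp (hS q hq)).1 h ▸ hq)
  | zero => simp [hp.ne_one]
  | one => simp [hp.ne_one]
  | add x y _ _ hx hy =>
    exact fun h => (hp.dvd_mul.1 (h.trans (Rat.add_den_dvd x y))).elim hx hy
  | neg x _ hx => simpa only [Rat.neg_den] using hx
  | mul x y _ _ hx hy =>
    exact fun h => (hp.dvd_mul.1 (h.trans (Rat.mul_den_dvd x y))).elim hx hy

theorem inv_mem_invertPrimes {S : Set ℕ} {d : ℕ} (hd : d ≠ 0)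
    (h : ∀ p, p.Prime → p ∣ d → p ∈ S) : (d : ℚ)⁻¹ ∈ invertPrimes S := by
  induction d using Nat.recOnMul with
  | zero => exact absurd rfl hd
  | one => simp
  | prime p hp => exact Subring.subset_closure ⟨p, h p hp dvd_rfl, rfl⟩
  | mul a b ha hb =>
    rw [Nat.cast_mul, mul_inv]
    exact mul_mem (ha (left_ne_zero_of_mul hd) fun p hp hpa => h p hp (hpa.mul_right b))
      (hb (right_ne_zero_of_mul hd) fun p hp hpb => h p hp (hpb.mul_left a))

theorem aeval_subring_eq_zero_iff {R : Subring ℚ} (φ : MvPolynomial ℕ ℤ) (x : ℕ → R) :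
    MvPolynomial.aeval x φ = 0 ↔ MvPolynomial.aeval (fun i => (x i : ℚ)) φ = 0 := by
  have h : MvPolynomial.aeval (fun i => (x i : ℚ)) φ = ((MvPolynomial.aeval x φ : R) : ℚ) :=
    MvPolynomial.aeval_algebraMap_apply ℚ x φ
  rw [h, ZeroMemClass.coe_eq_zero]

/-- Finitely many rational numbers whose denominators are prime to `P` have a common denominator
that is prime to `P`. -/
theorem exists_common_den (P n : ℕ) (x : ℕ → ℚ) (h : ∀ i < n, P.Coprime (x i).den) :
    ∃ d : ℕ, 0 < d ∧ P.Coprime d ∧ ∃ m : ℕ → ℤ, ∀ i < n, x i = m i / d := by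
  refine ⟨∏ i ∈ Finset.range n, (x i).den, Finset.prod_pos fun i _ => (x i).den_pos,
    Nat.Coprime.prod_right fun i hi => h i (Finset.mem_range.1 hi), ?_⟩
  have key : ∀ i, ∃ m : ℤ, i < n → x i = m / ((∏ i ∈ Finset.range n, (x i).den : ℕ) : ℚ) := by
    intro i
    by_cases hi : i < n
    · obtain ⟨k, hk⟩ := Finset.dvd_prod_of_mem (fun i => (x i).den) (Finset.mem_range.2 hi)
      have hne : ((∏ i ∈ Finset.range n, (x i).den : ℕ) : ℚ) ≠ 0 := by
        exact_mod_cast (Finset.prod_pos fun i _ => (x i).den_pos).ne'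
      refine ⟨(x i).num * k, fun _ => ?_⟩
      rw [eq_div_iff hne, hk]
      push_cast
      rw [← mul_assoc, Rat.mul_den_eq_num]
    · exact ⟨0, fun h => absurd h hi⟩
  choose m hm using key
  exact ⟨m, hm⟩

/-- The term list of a polynomial that has a root in some subring of `ℚ` (equivalently, in all of
them) if and only if `c` has a rational root: the equation is homogenized, and the denominator is
required to be `1` plus a sum of four squares. -/
def fractionTerms (c : List (ℤ × List ℕ)) : List (ℤ × List ℕ) :=
  sqTerms (homTerms c) ++ sqTerms (subTerms (varTerms 0)
    (constTerms 1 ++ ((normTerms 1 (varTerms 1) (varTerms 2)) ++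
      normTerms 1 (varTerms 3) (varTerms 4))))

theorem Primrec.fractionTerms : Primrec fractionTerms :=
  Primrec.append_terms (Primrec.sq_terms Primrec.homTerms) (.const _)

/-- A denominator of the form 1 plus squares is never zero, so dividing by it gives a rational root.
Conversely, a rational root has a positive integer common denominator `d`, and Lagrange writes `d -
1` as four squares; the resulting root is integral and lies in every `R`. -/
theorem exists_aeval_fractionTerms_iff (R : Subring ℚ) (c : List (ℤ × List ℕ)) :
    (∃ x : ℕ → R, MvPolynomial.aeval x (polyOfTerms (fractionTerms c)) = 0) ↔
      ∃ x : ℕ → ℚ, MvPolynomial.aeval x (polyOfTerms c) = 0 := by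
  have key : ∀ x : ℕ → ℚ, MvPolynomial.aeval x (polyOfTerms (fractionTerms c)) = 0 ↔
      MvPolynomial.aeval x (polyOfTerms (homTerms c)) = 0 ∧
        x 0 = 1 + (x 1 ^ 2 + x 2 ^ 2 + (x 3 ^ 2 + x 4 ^ 2)) := by
    intro x
    have : MvPolynomial.aeval x (polyOfTerms (fractionTerms c)) =
        (MvPolynomial.aeval x (polyOfTerms (homTerms c))) ^ 2 +
          (x 0 - (1 + (x 1 ^ 2 + x 2 ^ 2 + (x 3 ^ 2 + x 4 ^ 2)))) ^ 2 := by
      simp [fractionTerms, normTerms, add_assoc]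
    rw [this, add_eq_zero_iff_of_nonneg (sq_nonneg _) (sq_nonneg _),
      pow_eq_zero_iff two_ne_zero, pow_eq_zero_iff two_ne_zero, sub_eq_zero]
  simp only [aeval_subring_eq_zero_iff, key]
  constructor
  · rintro ⟨x, h1, h2⟩
    have h0 : (x 0 : ℚ) ≠ 0 := by rw [h2]; positivity
    rw [aeval_polyOfTerms, evalTerms_homTerms c _ h0, mul_eq_zero,
      or_iff_right (pow_ne_zero _ h0)] at h1
    exact ⟨_, (aeval_polyOfTerms _ _).trans h1⟩
  · rintro ⟨x, hx⟩
    obtain ⟨d, hd, -, m, hm⟩ := exists_common_den 1 (varBound c) x fun _ _ => Nat.coprime_one_left _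
    obtain ⟨a, b, e, f, habef⟩ := Nat.sum_four_squares (d - 1)
    have hd' : (d : ℚ) = 1 + ((a : ℚ) ^ 2 + (b : ℚ) ^ 2 + ((e : ℚ) ^ 2 + (f : ℚ) ^ 2)) := by
      have : d = 1 + (a ^ 2 + b ^ 2 + (e ^ 2 + f ^ 2)) := by omega
      exact_mod_cast this
    let z : ℕ → ℤ := fun i => if i < 5 then [(d : ℤ), a, b, e, f].getD i 0 else m (i - 5)
    refine ⟨fun i => ((z i : ℤ) : R), ?_, ?_⟩
    · have hz0 : ((z 0 : ℤ) : ℚ) = d := by simp [z]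
      have h0 : ((z 0 : ℤ) : ℚ) ≠ 0 := by rw [hz0]; exact_mod_cast hd.ne'
      simp only [SubringClass.coe_intCast]
      rw [aeval_polyOfTerms, evalTerms_homTerms c (fun i => ((z i : ℤ) : ℚ)) h0, hz0, ← mul_zero]
      congr 1
      rw [← hx, aeval_polyOfTerms]
      refine evalTerms_congr fun i hi => ?_
      rw [hm i hi]
      simp [z]
    · simpa [z] using hd'

end Subrings

/-! ### The stages and the search for witnesses -/

section Construction

/-- The products of distinct primes that occur as stages of the construction. -/
structure IsStage (P : ℕ) : Prop where
  squarefree : Squarefree P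
  one_lt : 1 < P
  prime_mod_four : ∀ p : ℕ, p.Prime → p ∣ P → p % 4 = 3
  prime_ne_three : ∀ p : ℕ, p.Prime → p ∣ P → p ≠ 3

theorem isStage_seven : IsStage 7 := by
  have h7 : Nat.Prime 7 := by norm_num
  refine ⟨h7.prime.squarefree, by norm_num, fun p hp h => ?_, fun p hp h => ?_⟩
  · rw [(Nat.prime_dvd_prime_iff_eq hp h7).1 h]
  · rw [(Nat.prime_dvd_prime_iff_eq hp h7).1 h]
    norm_num

theorem IsStage.mul {P q : ℕ} (hP : IsStage P) (hq : q.Prime) (hq4 : q % 4 = 3) (hlt : P < q) :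
    IsStage (P * q) := by
  have hP1 := hP.one_lt
  have hco : P.Coprime q :=
    ((Nat.Prime.coprime_iff_not_dvd hq).2 (Nat.not_dvd_of_pos_of_lt (by omega) hlt)).symm
  refine ⟨(Nat.squarefree_mul hco).2 ⟨hP.squarefree, hq.prime.squarefree⟩, ?_,
    fun p hp h => ?_, fun p hp h => ?_⟩
  · nlinarith [hq.one_lt]
  · rcases hp.dvd_mul.1 h with h | h
    · exact hP.prime_mod_four p hp h
    · rwa [(Nat.prime_dvd_prime_iff_eq hp hq).1 h]
  · rcases hp.dvd_mul.1 h with h | h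
    · exact hP.prime_ne_three p hp h
    · rw [(Nat.prime_dvd_prime_iff_eq hp hq).1 h]
      rintro rfl
      -- `q = 3` would force `1 < P < 3`, but 2 is not 3 mod 4.
      obtain rfl : P = 2 := by omega
      exact absurd (hP.prime_mod_four 2 Nat.prime_two dvd_rfl) (by norm_num)

/-- The conditions on a stage are exactly those under which both the valuation obstruction and the
construction via Dirichlet apply. -/
theorem IsStage.integralityCondition_iff {P : ℕ} (hP : IsStage P) (t : ℚ) :
    IntegralityCondition P t ↔ P.Coprime t.den := by
  refine ⟨fun h => Nat.Coprime.symm <| Nat.coprime_of_dvd fun p hp hpt hpP => ?_, fun h => ?_⟩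
  · have : Fact p.Prime := ⟨hp⟩
    exact h.not_dvd_den hP.squarefree hpP (hP.prime_mod_four p hp hpP)
      (hP.prime_ne_three p hp hpP) hpt
  · have hne : ∀ q : ℕ, q.Prime → q % 4 ≠ 3 ∨ q = 3 → P.Coprime q := fun q hq h =>
      ((Nat.Prime.coprime_iff_not_dvd hq).2 fun hd => h.elim
        (fun h => h (hP.prime_mod_four q hq hd)) (hP.prime_ne_three q hq hd)).symm
    refine integralityCondition_of_coprime ?_ ?_ (hne 3 Nat.prime_three (.inr rfl)) h
    · rintro ⟨r, hr⟩
      have h1 := hP.squarefree r ⟨1, by rw [hr, mul_one]⟩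
      have h2 := hP.one_lt
      rw [Nat.isUnit_iff.1 h1] at hr
      omega
    · exact Nat.coprime_two_right.1 (hne 2 Nat.prime_two (.inl (by norm_num)))

/-- A number `q` that is prime, `3` modulo `4` and large, together with, if `b = 1`, a root of `c`
with a common denominator `d` that is invertible modulo `P`. -/
def IsWitness (c : List (ℤ × List ℕ)) (P b : ℕ) (w : ℕ × ℕ × ℕ × List ℤ) : Prop :=
  (w.1.Prime ∧ w.1 % 4 = 3) ∧ (P * w.2.1 < w.1 ∧ 0 < w.2.1) ∧
    (¬ b = 1 ∨ (w.2.2.1 * w.2.1) % P = 1 ∧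
      evalTerms (homTerms c) (fun i => ((w.2.1 : ℤ) :: 0 :: 0 :: 0 :: 0 :: w.2.2.2).getD i 0) = 0)

theorem primrecPred_isWitness : PrimrecPred
    fun x : ((List (ℤ × List ℕ)) × ℕ × ℕ) × (ℕ × ℕ × ℕ × List ℤ) =>
      IsWitness x.1.1 x.1.2.1 x.1.2.2 x.2 := by
  have c : Primrec fun x : ((List (ℤ × List ℕ)) × ℕ × ℕ) × (ℕ × ℕ × ℕ × List ℤ) => x.1.1 :=
    Primrec.fst.comp .fst
  have P : Primrec fun x : ((List (ℤ × List ℕ)) × ℕ × ℕ) × (ℕ × ℕ × ℕ × List ℤ) => x.1.2.1 :=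
    Primrec.fst.comp (Primrec.snd.comp .fst)
  have b : Primrec fun x : ((List (ℤ × List ℕ)) × ℕ × ℕ) × (ℕ × ℕ × ℕ × List ℤ) => x.1.2.2 :=
    Primrec.snd.comp (Primrec.snd.comp .fst)
  have q : Primrec fun x : ((List (ℤ × List ℕ)) × ℕ × ℕ) × (ℕ × ℕ × ℕ × List ℤ) => x.2.1 :=
    Primrec.fst.comp .snd
  have d : Primrec fun x : ((List (ℤ × List ℕ)) × ℕ × ℕ) × (ℕ × ℕ × ℕ × List ℤ) => x.2.2.1 :=
    Primrec.fst.comp (Primrec.snd.comp .snd)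
  have u : Primrec fun x : ((List (ℤ × List ℕ)) × ℕ × ℕ) × (ℕ × ℕ × ℕ × List ℤ) => x.2.2.2.1 :=
    Primrec.fst.comp (Primrec.snd.comp (Primrec.snd.comp .snd))
  have l : Primrec fun x : ((List (ℤ × List ℕ)) × ℕ × ℕ) × (ℕ × ℕ × ℕ × List ℤ) => x.2.2.2.2 :=
    Primrec.snd.comp (Primrec.snd.comp (Primrec.snd.comp .snd))
  have w := Primrec.list_cons.comp (Primrec.int_natCast.comp d) <|
    Primrec.list_cons.comp (.const (0 : ℤ)) <| Primrec.list_cons.comp (.const (0 : ℤ)) <|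
      Primrec.list_cons.comp (.const (0 : ℤ)) <| Primrec.list_cons.comp (.const (0 : ℤ)) l
  exact ((Nat.prime_primrec.comp q).and
      (Primrec.eq.comp (Primrec.nat_mod.comp q (.const 4)) (.const 3))).and <|
    ((Primrec.nat_lt.comp (Primrec.nat_mul.comp P d) q).and
      (Primrec.nat_lt.comp (.const 0) d)).and <|
    (Primrec.eq.comp b (.const 1)).not.or <|
    (Primrec.eq.comp (Primrec.nat_mod.comp (Primrec.nat_mul.comp u d) P) (.const 1)).and
      (Primrec.eq.comp (Primrec.evalTerms.comp (Primrec.homTerms.comp c) w) (.const 0))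

theorem IsStage.exists_isWitness {P b : ℕ} {c : List (ℤ × List ℕ)} (hP : IsStage P)
    (hb : b = 1 → ∃ x : ℕ → ℚ, MvPolynomial.aeval x (polyOfTerms (queryTerms P c)) = 0) :
    ∃ w, IsWitness c P b w := by
  have hprime : ∀ n, ∃ q, n < q ∧ q.Prime ∧ q % 4 = 3 := fun n => by
    obtain ⟨q, h1, h2, h3⟩ := Nat.forall_exists_prime_gt_and_modEq n (q := 4) (a := 3) (by norm_num)
      (by norm_num)
    exact ⟨q, h1, h2, h3⟩
  by_cases h : b = 1
  · obtain ⟨x, hx, hxP⟩ := (exists_aeval_queryTerms_iff P c).1 (hb h)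
    obtain ⟨d, hd, hPd, m, hm⟩ := exists_common_den P (varBound c) x
      fun i hi => (hP.integralityCondition_iff _).1 (hxP i hi)
    obtain ⟨q, hq, hq1, hq2⟩ := hprime (P * d)
    obtain ⟨u, hu⟩ := Nat.exists_mul_mod_eq_one_of_coprime hPd.symm hP.one_lt
    refine ⟨(q, d, u, (List.range (varBound c)).map m), ⟨hq1, hq2⟩, ⟨hq, hd⟩, .inr ⟨?_, ?_⟩⟩
    · rw [mul_comm]; exact hu.2
    · refine (Int.evalTerms_zero_iff _ _ (by simpa using hd.ne')).2 ?_
      rw [← hx, aeval_polyOfTerms]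
      refine evalTerms_congr fun i hi => ?_
      rw [hm i hi]
      simp [List.getD_eq_getElem?_getD, hi]
  · obtain ⟨q, hq, hq1, hq2⟩ := hprime (P * 1)
    -- After a negative answer only the new prime matters; the remaining entries are placeholders.
    exact ⟨(q, 1, 0, []), ⟨hq1, hq2⟩, ⟨hq, one_pos⟩, .inl h⟩

/-- A partial recursive search for witnesses. -/
theorem exists_partrec_step {c : ℕ → List (ℤ × List ℕ)} (hc : Computable c) :
    ∃ step : ℕ × ℕ × ℕ →. ℕ, Partrec step ∧ ∀ n P b, (∃ w, IsWitness (c n) P b w) →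
      ∃ w, IsWitness (c n) P b w ∧ P * w.1 ∈ step (n, P, b) := by
  classical
  have hchk : Computable₂ fun (x : ℕ × ℕ × ℕ) (k : ℕ) => decide
      (IsWitness (c x.1) x.2.1 x.2.2 (Denumerable.ofNat (ℕ × ℕ × ℕ × List ℤ) k)) := by
    have h1 : Computable fun p : (ℕ × ℕ × ℕ) × ℕ =>
        ((c p.1.1, p.1.2), Denumerable.ofNat (ℕ × ℕ × ℕ × List ℤ) p.2) :=
      ((hc.comp (Computable.fst.comp .fst)).pair (Computable.snd.comp .fst)).pair
        ((Computable.ofNat (ℕ × ℕ × ℕ × List ℤ)).comp .snd)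
    exact (primrecPred_isWitness.decide.to_comp.comp h1).of_eq fun p => rfl
  have hout : Computable₂ fun (x : ℕ × ℕ × ℕ) (k : ℕ) =>
      x.2.1 * (Denumerable.ofNat (ℕ × ℕ × ℕ × List ℤ) k).1 :=
    Primrec.nat_mul.to_comp.comp (Computable.fst.comp (Computable.snd.comp .fst))
      (Computable.fst.comp ((Computable.ofNat (ℕ × ℕ × ℕ × List ℤ)).comp .snd))
  refine ⟨_, (Partrec.rfind hchk.partrec₂).map hout, fun n P b ⟨w, hw⟩ => ?_⟩
  have hex : ∃ k, IsWitness (c n) P b (Denumerable.ofNat (ℕ × ℕ × ℕ × List ℤ) k) :=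
    ⟨Encodable.encode w, by rwa [Denumerable.ofNat_encode]⟩
  have hspec := Nat.find_spec hex
  have hmin : ∀ {m : ℕ}, m < Nat.find hex → _ := fun {m} hm => Nat.find_min hex hm
  generalize Nat.find hex = k at hspec hmin
  exact ⟨_, hspec, Part.mem_map _ (Nat.mem_rfind.2
    ⟨by simpa using hspec, fun {m} hm => by simpa using hmin hm⟩)⟩

/-- The stages of the construction, with the witnesses that lead from one stage to the next. -/
theorem exists_stages (c : ℕ → List (ℤ × List ℕ)) (hc : Computable c)
    (idx : List (ℤ × List ℕ) → ℕ) (hidx : Computable idx) (H : ℕ → ℕ)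
    (hH : ∀ t, H (idx t) = 1 ↔ ∃ x : ℕ → ℚ, MvPolynomial.aeval x (polyOfTerms t) = 0) :
    ∃ (s : ℕ → ℕ) (w : ℕ → ℕ × ℕ × ℕ × List ℤ),
      (∀ n, IsStage (s n)) ∧
      (∀ n, IsWitness (c n) (s n) (H (idx (queryTerms (s n) (c n)))) (w n)) ∧
      (∀ n, s (n + 1) = s n * (w n).1) ∧
      Nat.RecursiveIn {(H : ℕ →. ℕ)} (s : ℕ →. ℕ) := by
  obtain ⟨step, hstep, hspec⟩ := exists_partrec_step hc
  have hex : ∀ (n : ℕ) (P : {P // IsStage P}), ∃ w,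
      IsWitness (c n) P.1 (H (idx (queryTerms P.1 (c n)))) w ∧
        P.1 * w.1 ∈ step (n, P.1, H (idx (queryTerms P.1 (c n)))) := fun n P =>
    hspec _ _ _ (P.2.exists_isWitness fun h => (hH _).1 h)
  choose next hnext hmem using hex
  -- The recursion runs through genuine stages, since only for these is the search known to
  -- terminate. The start 7 is a prime that is 3 mod 4 and not 3.
  let st : ℕ → {P // IsStage P} := fun n => Nat.rec ⟨7, isStage_seven⟩
    (fun n P => ⟨P.1 * (next n P).1, P.2.mul (hnext n P).1.1 (hnext n P).1.2
      (lt_of_le_of_lt (Nat.le_mul_of_pos_right _ (hnext n P).2.1.2) (hnext n P).2.1.1)⟩) n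
  refine ⟨fun n => (st n).1, fun n => next n (st n), fun n => (st n).2, fun n => hnext n (st n),
    fun n => rfl, ?_⟩
  have hq : Computable fun p : ℕ × ℕ => idx (queryTerms p.2 (c p.1)) :=
    hidx.comp (Primrec.queryTerms.to_comp.comp Computable.snd (hc.comp .fst))
  exact Nat.RecursiveIn.iterate (Set.mem_singleton _) hq hstep fun n => hmem n (st n)

end Construction

/-! ### The main theorem -/

theorem mainTheorem5 (f : ℕ → MvPolynomial ℕ ℤ) (hf : IsComputableEnumeration f) :
    ∃ S : Set ℕ, (∀ p ∈ S, p.Prime) ∧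
      charFn (HTP f (invertPrimes S)) ≡ᵀ charFn (HTP f ℚ) ∧
      charFn S ≤ᵀ charFn (HTP f ℚ) ∧
      ({p : ℕ | p.Prime} \ S).Infinite := by
  classical
  obtain ⟨idx, hidx, hfidx⟩ := hf.exists_index
  obtain ⟨-, c, hc, hfc⟩ := hf
  have hH : ∀ e, (HTP f ℚ).indicator (1 : ℕ → ℕ) e = 1 ↔ e ∈ HTP f ℚ := fun e => by
    by_cases he : e ∈ HTP f ℚ <;> simp [he]
  obtain ⟨s, w, hs, hw, hsucc, hrec⟩ := exists_stages c hc idx hidx _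
    fun t => (hH (idx t)).trans (by rw [HTP, Set.mem_ofPred_eq, hfidx])
  have hlt : ∀ n, s n * (w n).2.1 < (w n).1 := fun n => (hw n).2.1.1
  have hd : ∀ n, 0 < (w n).2.1 := fun n => (hw n).2.1.2
  have hlt' : ∀ n, s n < (w n).1 := fun n =>
    lt_of_le_of_lt (Nat.le_mul_of_pos_right _ (hd n)) (hlt n)
  have hq : ∀ n, (w n).1.Prime := fun n => (hw n).1.1
  have hdvd : ∀ n m, n ≤ m → s n ∣ s m := fun n m h => by
    induction m, h using Nat.le_induction with
    | base => exact dvd_rfl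
    | succ m _ ih => exact hsucc m ▸ ih.mul_right _
  have hmono : Monotone s := fun n m h =>
    Nat.le_of_dvd (by have := (hs m).one_lt; omega) (hdvd n m h)
  have hid : ∀ n, n < s n := fun n => by
    induction n with
    | zero => have := (hs 0).one_lt; omega
    | succ n ih =>
      have h1 := hsucc n
      have h2 := hlt' n
      have h3 := (hs n).one_lt
      nlinarith
  -- A prime smaller than all the primes still to be excluded is safe once it does not divide the
  -- current stage.
  have hnew : ∀ n p : ℕ, p.Prime → ¬ p ∣ s n → (∀ k, n ≤ k → p < (w k).1) → ∀ m, ¬ p ∣ s m := by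
    intro n p hp hn hk m hm
    rcases le_total m n with h | h
    · exact hn (hm.trans (hdvd m n h))
    · induction m, h using Nat.le_induction with
      | base => exact hn hm
      | succ m h ih =>
        rw [hsucc m] at hm
        rcases hp.dvd_mul.1 hm with h1 | h1
        · exact ih h1
        · exact (hk m h).ne ((Nat.prime_dvd_prime_iff_eq hp (hq m)).1 h1)
  set S : Set ℕ := {p | p.Prime ∧ ∀ n, ¬ p ∣ s n} with hS
  have hSp : ∀ p ∈ S, p.Prime := fun p hp => hp.1
  -- From stage `p` on, every excluded prime exceeds `s p > p`, so membership of `p` is settled by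
  -- then; this makes `S` computable from `s`.
  have hS_iff : ∀ p, p ∈ S ↔ p.Prime ∧ ¬ p ∣ s p := fun p =>
    ⟨fun h => ⟨h.1, h.2 p⟩, fun h => ⟨h.1, hnew p p h.1 h.2 fun k hk =>
      lt_of_lt_of_le (hid p) ((hmono hk).trans (hlt' k).le)⟩⟩
  have hHTP : ∀ e, e ∈ HTP f (invertPrimes S) ↔ idx (queryTerms (s e) (c e)) ∈ HTP f ℚ := by
    intro e
    have hR : e ∈ HTP f (invertPrimes S) ↔ ∃ x : ℕ → invertPrimes S,
        MvPolynomial.aeval (fun i => (x i : ℚ)) (polyOfTerms (c e)) = 0 := by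
      simp only [HTP, Set.mem_ofPred_eq, hfc e, aeval_subring_eq_zero_iff]
    rw [hR]
    constructor
    · rintro ⟨x, hx⟩
      rw [HTP, Set.mem_ofPred_eq, hfidx, exists_aeval_queryTerms_iff]
      refine ⟨_, hx, fun i _ => ((hs e).integralityCondition_iff _).2 ?_⟩
      refine Nat.coprime_of_dvd fun p hp hpe => ?_
      exact Rat.den_not_dvd_of_mem_invertPrimes hSp hp (fun h => h.2 e hpe) (x i).2
    · intro he
      obtain ⟨hinv, hzero⟩ := (hw e).2.2.resolve_left (not_not.2 ((hH _).2 he))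
      set d := (w e).2.1 with hde
      -- A prime factor of `d` does not divide `s e`, as `d` is invertible mod `s e`, and it is at
      -- most `d`, hence below every prime excluded from stage `e` on.
      have hdS : (d : ℚ)⁻¹ ∈ invertPrimes S := by
        refine inv_mem_invertPrimes (hd e).ne' fun p hp hpd =>
          ⟨hp, hnew e p hp (fun hpe => ?_) fun k hk => ?_⟩
        · have h1 := (Nat.dvd_mod_iff hpe).2 (hpd.mul_left (w e).2.2.1)
          rw [hinv] at h1
          exact hp.one_lt.ne' (Nat.dvd_one.1 h1)
        · refine lt_of_le_of_lt (Nat.le_of_dvd (hd e) hpd) ?_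
          have h0 : d < (w e).1 := lt_of_le_of_lt
            (Nat.le_mul_of_pos_left _ (by have := (hs e).one_lt; omega)) (hlt e)
          rcases hk.eq_or_lt with rfl | hk
          · exact h0
          · have h1 : (w e).1 ≤ s (e + 1) := by
              rw [hsucc e]
              exact Nat.le_mul_of_pos_left _ (by have := (hs e).one_lt; omega)
            exact h0.trans_le (h1.trans ((hmono hk).trans (hlt' k).le))
      rw [Int.evalTerms_zero_iff _ _ (by simpa using (hd e).ne')] at hzero
      refine ⟨fun i => ⟨_, mul_mem (intCast_mem (invertPrimes S) ((w e).2.2.2.getD i 0)) hdS⟩, ?_⟩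
      rw [aeval_polyOfTerms, ← hzero]
      refine evalTerms_congr fun i _ => ?_
      simp [div_eq_mul_inv]
  have hsrec : Nat.RecursiveIn {charFn (HTP f ℚ)} (s : ℕ →. ℕ) := hrec
  have hpair := Nat.RecursiveIn.pair_total (Nat.RecursiveIn.of_computable
    (O := {charFn (HTP f ℚ)}) Computable.id) hsrec
  refine ⟨S, hSp, ⟨?_, ?_⟩, ?_, ?_⟩
  · have hφ : Computable fun n : ℕ => idx (queryTerms n.unpair.2 (c n.unpair.1)) :=
      hidx.comp (Primrec.queryTerms.to_comp.comp (Computable.snd.comp .unpair)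
        (hc.comp (Computable.fst.comp .unpair)))
    have := (Nat.RecursiveIn.of_computable hφ).comp_total hpair
    simp only [Nat.unpair_pair, id] at this
    exact turingReducible_of_forall_mem_iff (RecursiveIn.iff_nat.2 this) hHTP
  · refine turingReducible_of_forall_mem_iff (r := fun e => idx (fractionTerms (c e)))
      (RecursiveIn.iff_nat.2 (Nat.RecursiveIn.of_computable
        (hidx.comp (Primrec.fractionTerms.to_comp.comp hc)))) fun e => ?_
    rw [HTP, HTP, Set.mem_ofPred_eq, Set.mem_ofPred_eq, hfidx, hfc,
      exists_aeval_fractionTerms_iff]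
  · have hφ : PrimrecPred fun n : ℕ => n.unpair.1.Prime ∧ ¬ n.unpair.2 % n.unpair.1 = 0 := by
      have h1 : Primrec fun n : ℕ => n.unpair.1 := Primrec.fst.comp .unpair
      have h2 : Primrec fun n : ℕ => n.unpair.2 := Primrec.snd.comp .unpair
      exact (Nat.prime_primrec.comp h1).and
        (Primrec.eq.comp (Primrec.nat_mod.comp h2 h1) (.const 0)).not
    have hφ' : Primrec fun n : ℕ =>
        if n.unpair.1.Prime ∧ ¬ n.unpair.2 % n.unpair.1 = 0 then 1 else 0 :=
      Primrec.ite hφ (.const 1) (.const 0)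
    have := (Nat.RecursiveIn.of_computable hφ'.to_comp).comp_total hpair
    refine RecursiveIn.iff_nat.2 (this.of_eq fun p => ?_)
    simp only [charFn, PFun.coe_val, Set.indicator_apply, Nat.unpair_pair, id, hS_iff,
      Nat.dvd_iff_mod_eq_zero, Pi.one_apply]
  -- The prime added at stage `n` divides `s (n + 1)`, so it is outside `S`, and it exceeds `s n >
  -- n`.
  · refine Set.infinite_of_forall_exists_gt fun n => ⟨(w n).1, ⟨hq n, fun h => ?_⟩, ?_⟩
    · exact h.2 (n + 1) (hsucc n ▸ dvd_mul_left _ _)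
    · exact (hid n).trans (hlt' n)
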